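/- **Setting.** For $L>0$ let $\mathbb T_3=(\mathbb R/L\mathbb Z)^3$ with Lebesgue measure, and let the wave vectors be $\mathbf k\in\frac{2\pi}{L}\mathbb Z^3$. For $s\ge 0$ let $\mathbb H_s$ be the space of zero-mean vector fields $\mathbf w=\sum_{\mathbf k\ne 0}\widehat{\mathbf w}_{\mathbf k}e^{i\mathbf k\cdot\mathbf x}\in L^2(\mathbb T_3)^3$, $\widehat{\mathbf w}_{\mathbf k}\in\mathbb C^3$, with $$\|\mathbf w\|_s^2=L^3\sum_{\mathbf k\neq 0}|\mathbf k|^{2s}|\widehat{\mathbf w}_{\mathbf k}|^2<\infty .$$ The factor $L^3$ makes $\|\cdot\|_0$ the $L^2(\mathbb T_3)$ norm, and $\|\cdot\|_0$ also denotes the $L^2$ norm (with the Euclidean norm of matrices) of matrix fields. For $s\in\{\frac12,1\}$ let $S_s$ be the Sobolev constant of the injection $\mathbb H_s\hookrightarrow L^{s^\star}(\mathbb T_3)^3$, $s^\star=\frac{6}{3-2s}$ (so $1^\star=6$, $(\frac12)^\star=3$), that is, the least $S\ge 0$ with $\|\mathbf w\|_{L^{s^\star}}\le S\|\mathbf w\|_s$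 for all $L>0$ and all $\mathbf w\in\mathbb H_s$. Let $\alpha>0$, $p\ge\frac34$, $N\in\mathbb N=\{0,1,2,\dots\}$, let $G$ be the generalised Helmholtz filter $G\mathbf w=\sum_{\mathbf k}\frac{1}{1+\alpha^{2p}|\mathbf k|^{2p}}\widehat{\mathbf w}_{\mathbf k}e^{i\mathbf k\cdot\mathbf x}$, write $\overline{\mathbf u}=G\mathbf u$, and let $D_N=\sum_{n=0}^N(I-G)^n$ be the deconvolution operator. **Lemma.** The constants $S_1$ and $S_{1/2}$ exist (are finite); put $C=S_1S_{1/2}$, which does not depend on $L,\alpha,p,N$. For all $L>0$, $\alpha>0$, $p\ge \frac34$, $N\in\mathbb N$ and every $\mathbf u\in\mathbb H_1$ (in particular for a real, divergence-free velocity field at any fixed time at which it lies in $\mathbb H_1$), the residual stress $\boldsymbol\tau_N=\mathbf u\otimes\mathbf u-D_N\overline{\mathbf u}\otimes D_N\overline{\mathbf u}$ satisfies $$\|\boldsymbol\tau_N\|_0^2\le 2C\,\|\mathbf u\|_1^2\,\|\mathbf u-D_N\overline{\mathbf u}\|_{1/2}^2,$$ and $\mathbf u-D_N\overline{\mathbf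 u}\in\mathbb H_{1/2}$ with $$\|\mathbf u-D_N\overline{\mathbf u}\|_{1/2}^2\le\frac{\alpha}{(2p(N+1))^{1/(2p)}}\,\|\mathbf u\|_1^2 .$$ -/

import Mathlib

open MeasureTheory

noncomputable section

namespace DeconvResidual

/-- The three-dimensional torus `(ℝ / L ℤ)³`, the periodic box of size `L`.  Its `volume` is
Lebesgue measure, of total mass `L ^ 3`. -/
abbrev Torus (L : ℝ) : Type := Fin 3 → AddCircle L

/-- `ℂ³` with its Hermitian norm. -/
abbrev Vec : Type := EuclideanSpace ℂ (Fin 3)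

/-- Square integrable vector fields on the torus. -/
abbrev L2Field (L : ℝ) [Fact (0 < L)] : Type := Lp Vec 2 (volume : Measure (Torus L))

/-- The length `|k|` of the wave vector `k = 2 π n / L`, for `n ∈ ℤ³`. -/
def waveLength (L : ℝ) (n : Fin 3 → ℤ) : ℝ :=
  2 * Real.pi / L * Real.sqrt (∑ i, (n i : ℝ) ^ 2)

/-- The exponential `x ↦ e^{i k · x}` with `k = 2 π n / L`. -/
def expMode (L : ℝ) (n : Fin 3 → ℤ) : C(Torus L, ℂ) :=
  ⟨fun x => ∏ i, fourier (n i) (x i), by fun_prop⟩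

/-- The vector field `x ↦ e^{i k · x} a` with `k = 2 π n / L`, as a continuous function. -/
def modeFun (L : ℝ) (n : Fin 3 → ℤ) (a : Vec) : C(Torus L, Vec) :=
  ⟨fun x => expMode L n x • a, by fun_prop⟩

/-- The vector field `x ↦ e^{i k · x} a` with `k = 2 π n / L`, as an element of `L²`. -/
def mode (L : ℝ) [Fact (0 < L)] (n : Fin 3 → ℤ) (a : Vec) : L2Field L :=
  ContinuousMap.toLp (E := Vec) 2 (volume : Measure (Torus L)) ℂ (modeFun L n a)

/-- The Fourier coefficient `ŵ_k = L⁻³ ∫ e^{- i k · x} w(x) dx` with `k = 2 π n / L`. -/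
def coeff (L : ℝ) [Fact (0 < L)] (w : L2Field L) (n : Fin 3 → ℤ) : Vec :=
  ((L : ℂ) ^ 3)⁻¹ • ∫ x : Torus L, starRingEnd ℂ (expMode L n x) • w x

/-- The space `ℍ_s` for `s ≥ 0`: the fields `w = ∑ ŵ_k e^{i k · x}` (convergence in `L²`) of zero
mean with `∑ |k|^{2s} |ŵ_k|² < ∞`. -/
def HSpace (L : ℝ) [Fact (0 < L)] (s : ℝ) : Set (L2Field L) :=
  {w | HasSum (fun n => mode L n (coeff L w n)) w ∧ coeff L w 0 = 0 ∧
    Summable fun n => waveLength L n ^ (2 * s) * ‖coeff L w n‖ ^ 2}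

/-- The norm `‖w‖_s = (L³ ∑ |k|^{2s} |ŵ_k|²)^{1/2}` of `ℍ_s`; the volume factor `L³` makes `‖·‖_0`
the norm of `L²`. -/
def hNorm (L : ℝ) [Fact (0 < L)] (s : ℝ) (w : L2Field L) : ℝ :=
  Real.sqrt (L ^ 3 * ∑' n, waveLength L n ^ (2 * s) * ‖coeff L w n‖ ^ 2)

/-- `S` is admissible in the Sobolev inequality `‖w‖_{L^{s*}} ≤ S ‖w‖_s`, `s* = 6 / (3 - 2 s)`, for
all fields in `ℍ_s` on all boxes. -/
def IsSobolevBound (s S : ℝ) : Prop :=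
  0 ≤ S ∧ ∀ (L : ℝ) [Fact (0 < L)], ∀ w ∈ HSpace L s,
    eLpNorm w (ENNReal.ofReal (6 / (3 - 2 * s))) volume ≤ ENNReal.ofReal (S * hNorm L s w)

/-- The Sobolev constant `S_s`: the best admissible constant. -/
def sobolevConst (s : ℝ) : ℝ := sInf {S | IsSobolevBound s S}

/-- The generalised Helmholtz filter `G`,
`∑ ŵ_k e^{i k · x} ↦ ∑ (1 + α^{2p} |k|^{2p})⁻¹ ŵ_k e^{i k · x}`. -/
def filterG (L : ℝ) [Fact (0 < L)] (α p : ℝ) (w : L2Field L) : L2Field L :=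
  ∑' n, mode L n ((1 / (1 + α ^ (2 * p) * waveLength L n ^ (2 * p))) • coeff L w n)

/-- The deconvolution operator `D_N = ∑_{0 ≤ j ≤ N} (I - G)^j`. -/
def deconv (L : ℝ) [Fact (0 < L)] (α p : ℝ) (N : ℕ) (w : L2Field L) : L2Field L :=
  ∑ j ∈ Finset.range (N + 1), (fun v => v - filterG L α p v)^[j] w

/-- The residual stress `τ_N = u ⊗ u - D_N ū ⊗ D_N ū`, where `ū = G u`. -/
def residualStress (L : ℝ) [Fact (0 < L)] (α p : ℝ) (N : ℕ) (u : L2Field L) (x : Torus L) :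
    Matrix (Fin 3) (Fin 3) ℂ :=
  Matrix.of fun i j => u x i * u x j
    - deconv L α p N (filterG L α p u) x i * deconv L α p N (filterG L α p u) x j

/-- The squared `L²` norm `∫ ∑_{i j} |τ_{i j}(x)|² dx` of a matrix field. -/
def l2NormSq (L : ℝ) [Fact (0 < L)] (τ : Torus L → Matrix (Fin 3) (Fin 3) ℂ) : ENNReal :=
  ∫⁻ x, ∑ i, ∑ j, ‖τ x i j‖ₑ ^ 2

end DeconvResidual

end

open MeasureTheory

noncomputable section

namespace DeconvResidual

variable {L : ℝ} [Fact (0 < L)]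

/-! ### Orthogonality of the Fourier modes -/

/-! On Fourier coefficients everything is diagonal. With `g = 1 / (1 + (α|k|)^{2p})` the symbol of
`G`, the geometric sum gives `D_N G` the symbol `1 - (1 - g)^(N+1)`, so the error `w = u - D_N ū`
has symbol `(1 - g)^(N+1)`. Bernoulli's inequality bounds the square of this by a constant times
`α|k|` (`pow_div_one_add_le`, `errorSymbol_sq_le`), and this extra factor `|k|` turns the `1/2`-norm
of `w` into the `1`-norm of `u`.

For the stress, write `u ⊗ u - v ⊗ v = u ⊗ w + w ⊗ v` with `v = D_N ū`. Hölder with `1/2 = 1/3 +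
1/6`, the two Sobolev inequalities and `‖v‖_1 ≤ ‖u‖_1` give the bound with constant `4C²`. This is
at most `2C` exactly when `C ≤ 1/2` (or `C = 0`), so finiteness of the Sobolev constants is not
enough: explicit bounds are needed, namely `S_1 ≤ 3/5` and `S_{1/2} ≤ 5/6`, whose product is `1/2`.

These come from truncation by the heat flow. At each level `l`, run the flow for a time `t(l)` long
enough that the sum of the moduli of the Fourier coefficients of `e^{tΔ}w` is at most `l`. Then
`(|w| - l)₊ ≤ |w - e^{tΔ}w|`, whose `L²` norm is known by Parseval, and integrating against `l^m dl`
recovers the `L^{m+3}` norm (`HasSeries.lintegral_pow_le`). The choice of `t(l)` rests on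
Cauchy–Schwarz and on Gaussian lattice sums bounded uniformly in `L`, which follow from the
functional equation of the theta series (`theta_cube_le`). -/

lemma integral_fourier (n : ℤ) :
    ∫ x : AddCircle L, fourier n x = if n = 0 then (L : ℂ) else 0 := by
  have hL : 0 < L := Fact.out
  have key : ∫ x : AddCircle L, fourier n x ∂AddCircle.haarAddCircle = if n = 0 then 1 else 0 := by
    have := (orthonormal_iff_ite.1 (orthonormal_fourier (T := L))) 0 n
    rw [ContinuousMap.inner_toLp] at this
    simpa [eq_comm] using this
  rw [AddCircle.volume_eq_smul_haarAddCircle, integral_smul_measure, key,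
    ENNReal.toReal_ofReal hL.le]
  split_ifs <;> simp

omit [Fact (0 < L)] in
lemma conj_expMode_mul (n m : Fin 3 → ℤ) (x : Torus L) :
    starRingEnd ℂ (expMode L n x) * expMode L m x = ∏ i, fourier (m i - n i) (x i) := by
  simp only [expMode, ContinuousMap.coe_mk, map_prod, ← Finset.prod_mul_distrib]
  refine Finset.prod_congr rfl fun i _ => ?_
  rw [← fourier_neg, ← fourier_add, neg_add_eq_sub]

lemma integral_conj_expMode_mul (n m : Fin 3 → ℤ) :
    ∫ x : Torus L, starRingEnd ℂ (expMode L n x) * expMode L m x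
      = if n = m then (L : ℂ) ^ 3 else 0 := by
  simp_rw [conj_expMode_mul]
  rw [integral_fintype_prod_volume_eq_prod
    (fun i (y : AddCircle L) => (fourier (m i - n i) y : ℂ))]
  simp_rw [integral_fourier, sub_eq_zero]
  split_ifs with h
  · simp [h]
  · obtain ⟨i, hi⟩ := Function.ne_iff.1 h
    exact Finset.prod_eq_zero (Finset.mem_univ i) (if_neg (Ne.symm hi))

omit [Fact (0 < L)] in
lemma norm_expMode (n : Fin 3 → ℤ) (x : Torus L) : ‖expMode L n x‖ = 1 := by
  simp [expMode, norm_prod, fourier_apply, Circle.norm_coe]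

lemma mode_coeFn (n : Fin 3 → ℤ) (a : Vec) :
    mode L n a =ᵐ[volume] fun x => expMode L n x • a :=
  ContinuousMap.coeFn_toLp _ _

lemma mode_add (n : Fin 3 → ℤ) (a b : Vec) : mode L n (a + b) = mode L n a + mode L n b := by
  rw [mode, mode, mode, ← map_add]
  congr 1
  ext1 x
  exact smul_add _ _ _

lemma mode_smul (n : Fin 3 → ℤ) (c : ℂ) (a : Vec) : mode L n (c • a) = c • mode L n a := by
  rw [mode, mode, ← map_smul]
  congr 1
  ext1 x
  exact smul_comm _ _ _

lemma mode_sub (n : Fin 3 → ℤ) (a b : Vec) : mode L n (a - b) = mode L n a - mode L n b := by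
  rw [sub_eq_add_neg, ← neg_one_smul ℂ b, mode_add, mode_smul, neg_one_smul, ← sub_eq_add_neg]

lemma mode_zero (n : Fin 3 → ℤ) : mode L n 0 = 0 := by
  simpa using mode_smul (L := L) n 0 0

lemma inner_mode_left (n : Fin 3 → ℤ) (b : Vec) (w : L2Field L) :
    inner ℂ (mode L n b) w = (L : ℂ) ^ 3 * inner ℂ b (coeff L w n) := by
  have hL : (L : ℂ) ≠ 0 := by
    have : 0 < L := Fact.out
    exact_mod_cast this.ne'
  have hw : Integrable (fun x => w x) (volume : Measure (Torus L)) :=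
    (Lp.memLp w).integrable (by norm_num)
  have hint : Integrable (fun x => starRingEnd ℂ (expMode L n x) • w x)
      (volume : Measure (Torus L)) := by
    refine Integrable.bdd_smul (φ := fun x => starRingEnd ℂ (expMode L n x)) (C := 1) hw ?_ ?_
    · exact (Complex.continuous_conj.comp (expMode L n).continuous).aestronglyMeasurable
    · exact Filter.Eventually.of_forall fun x => by simp [norm_expMode]
  rw [L2.inner_def, coeff, inner_smul_right, mul_inv_cancel_left₀ (pow_ne_zero _ hL),
    ← integral_inner hint]
  refine integral_congr_ae ?_
  filter_upwards [mode_coeFn n b] with x hx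
  rw [hx, inner_smul_left, inner_smul_right]

lemma coeff_mode (n m : Fin 3 → ℤ) (a : Vec) :
    coeff L (mode L m a) n = if n = m then a else 0 := by
  have hL : (L : ℂ) ≠ 0 := by
    have : 0 < L := Fact.out
    exact_mod_cast this.ne'
  have : ∫ x : Torus L, starRingEnd ℂ (expMode L n x) • mode L m a x
      = (∫ x : Torus L, starRingEnd ℂ (expMode L n x) * expMode L m x) • a := by
    rw [← integral_smul_const]
    refine integral_congr_ae ?_
    filter_upwards [mode_coeFn m a] with x hx
    rw [hx, smul_smul]
  rw [coeff, this, integral_conj_expMode_mul]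
  split_ifs
  · rw [smul_smul, inv_mul_cancel₀ (pow_ne_zero _ hL), one_smul]
  · simp

lemma inner_mode_mode (n m : Fin 3 → ℤ) (a b : Vec) :
    inner ℂ (mode L n a) (mode L m b) = if n = m then (L : ℂ) ^ 3 * inner ℂ a b else 0 := by
  rw [inner_mode_left, coeff_mode]
  split_ifs <;> simp

lemma norm_mode_sq (n : Fin 3 → ℤ) (a : Vec) : ‖mode L n a‖ ^ 2 = L ^ 3 * ‖a‖ ^ 2 := by
  have h := inner_mode_mode (L := L) n n a a
  rw [if_pos rfl, inner_self_eq_norm_sq_to_K, inner_self_eq_norm_sq_to_K] at h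
  apply Complex.ofReal_injective
  simpa using h

/-- The isometric embedding of `ℂ³` onto the fields of wave vector `2 π n / L`. -/
def modeIsometry (L : ℝ) [Fact (0 < L)] (n : Fin 3 → ℤ) : Vec →ₗᵢ[ℂ] L2Field L where
  toFun a := mode L n (((Real.sqrt (L ^ 3))⁻¹ : ℂ) • a)
  map_add' a b := by rw [smul_add, mode_add]
  map_smul' c a := by rw [smul_comm, mode_smul]; rfl
  norm_map' a := by
    have hL : 0 < L := Fact.out
    have h3 : 0 < L ^ 3 := by positivity
    have h : ‖mode L n (((Real.sqrt (L ^ 3))⁻¹ : ℂ) • a)‖ ^ 2 = ‖a‖ ^ 2 := by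
      rw [norm_mode_sq, norm_smul, norm_inv, Complex.norm_real, Real.norm_of_nonneg
        (Real.sqrt_nonneg _), mul_pow, inv_pow, Real.sq_sqrt h3.le, mul_inv_cancel_left₀ h3.ne']
    exact (pow_left_inj₀ (norm_nonneg _) (norm_nonneg _) two_ne_zero).1 h

lemma orthogonalFamily_modeIsometry :
    OrthogonalFamily ℂ (fun _ : Fin 3 → ℤ => Vec) (modeIsometry L) := by
  intro n m hnm a b
  exact (inner_mode_mode n m _ _).trans (if_neg hnm)

lemma mode_eq_modeIsometry (n : Fin 3 → ℤ) (a : Vec) :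
    mode L n a = modeIsometry L n ((Real.sqrt (L ^ 3) : ℂ) • a) := by
  have hL : 0 < L := Fact.out
  have h3 : (Real.sqrt (L ^ 3) : ℂ) ≠ 0 := by
    have : 0 < Real.sqrt (L ^ 3) := Real.sqrt_pos.2 (by positivity)
    exact_mod_cast this.ne'
  change _ = mode L n _
  rw [smul_smul, inv_mul_cancel₀ h3, one_smul]

lemma summable_mode {a : (Fin 3 → ℤ) → Vec} (ha : Summable fun n => ‖a n‖ ^ 2) :
    Summable fun n => mode L n (a n) := by
  simp_rw [mode_eq_modeIsometry]
  refine (orthogonalFamily_modeIsometry.summable_iff_norm_sq_summable _).2 ?_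
  simp_rw [norm_smul, mul_pow]
  exact ha.mul_left _

/-! ### Fields given by a Fourier series -/

/-- `w = ∑ a_n e^{i k · x}` in `L²`. -/
def HasSeries (w : L2Field L) (a : (Fin 3 → ℤ) → Vec) : Prop :=
  HasSum (fun n => mode L n (a n)) w

namespace HasSeries

variable {v w : L2Field L} {a b : (Fin 3 → ℤ) → Vec}

lemma coeff_eq (h : HasSeries w a) (n : Fin 3 → ℤ) : coeff L w n = a n := by
  have hL : (L : ℂ) ≠ 0 := by
    have : 0 < L := Fact.out
    exact_mod_cast this.ne'
  refine ext_inner_left ℂ fun b => ?_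
  have h1 : HasSum (fun m => inner ℂ (mode L n b) (mode L m (a m))) (inner ℂ (mode L n b) w) :=
    h.mapL (innerSL ℂ (mode L n b))
  have h2 : HasSum (fun m => inner ℂ (mode L n b) (mode L m (a m)))
      (inner ℂ (mode L n b) (mode L n (a n))) := by
    refine hasSum_single n fun m hm => ?_
    rw [inner_mode_mode, if_neg hm.symm]
  have h3 := h1.unique h2
  rw [inner_mode_left, inner_mode_mode, if_pos rfl] at h3
  exact mul_left_cancel₀ (pow_ne_zero 3 hL) h3

/-- Parseval, obtained by pairing the series with its own sum. -/
lemma hasSum_norm_sq (h : HasSeries w a) : HasSum (fun n => L ^ 3 * ‖a n‖ ^ 2) (‖w‖ ^ 2) := by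
  have h1 : HasSum (fun m => inner ℂ w (mode L m (a m))) (inner ℂ w w) :=
    HasSum.mapL (innerSL ℂ w) h
  have h2 : ∀ m, inner ℂ w (mode L m (a m)) = ((L ^ 3 * ‖a m‖ ^ 2 : ℝ) : ℂ) := fun m => by
    rw [← inner_conj_symm, inner_mode_left, h.coeff_eq, inner_self_eq_norm_sq_to_K]
    simp
  simp_rw [h2, inner_self_eq_norm_sq_to_K] at h1
  refine Complex.hasSum_ofReal.1 ?_
  simpa using h1

lemma summable_norm_sq (h : HasSeries w a) : Summable fun n => ‖a n‖ ^ 2 := by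
  have hL : 0 < L := Fact.out
  have := h.hasSum_norm_sq.summable
  exact (summable_mul_left_iff (by positivity)).1 this

lemma sub (hv : HasSeries v a) (hw : HasSeries w b) :
    HasSeries (v - w) (fun n => a n - b n) := by
  have := HasSum.sub hv hw
  simp_rw [← mode_sub] at this
  exact this

lemma sum {ι : Type*} {s : Finset ι} {w : ι → L2Field L} {a : ι → (Fin 3 → ℤ) → Vec}
    (h : ∀ i ∈ s, HasSeries (w i) (a i)) :
    HasSeries (∑ i ∈ s, w i) (fun n => ∑ i ∈ s, a i n) := by
  have h1 : ∀ n, mode L n (∑ i ∈ s, a i n) = ∑ i ∈ s, mode L n (a i n) := fun n =>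
    map_sum (AddMonoidHom.mk' (mode L n) (mode_add n)) _ _
  unfold HasSeries
  simp_rw [h1]
  exact hasSum_sum h

lemma eq_zero (h : HasSeries w a) (ha : ∀ n, a n = 0) : w = 0 := by
  unfold HasSeries at h
  simp_rw [ha, mode_zero] at h
  exact h.unique hasSum_zero

end HasSeries

lemma exists_hasSeries {a : (Fin 3 → ℤ) → Vec} (ha : Summable fun n => ‖a n‖ ^ 2) :
    ∃ w : L2Field L, HasSeries w a :=
  ⟨_, (summable_mode ha).hasSum⟩

lemma summable_norm_sq_smul {a : (Fin 3 → ℤ) → Vec} (ha : Summable fun n => ‖a n‖ ^ 2)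
    {c : (Fin 3 → ℤ) → ℝ} (hc : ∀ n, |c n| ≤ 1) : Summable fun n => ‖c n • a n‖ ^ 2 := by
  refine ha.of_nonneg_of_le (fun n => by positivity) fun n => ?_
  rw [norm_smul]
  refine pow_le_pow_left₀ (by positivity) ?_ 2
  exact mul_le_of_le_one_left (norm_nonneg _) (hc n)

/-! ### Lengths of the wave vectors -/

lemma waveLength_nonneg (n : Fin 3 → ℤ) : 0 ≤ waveLength L n := by
  have hL : 0 < L := Fact.out
  unfold waveLength
  positivity

lemma waveLength_pos {n : Fin 3 → ℤ} (hn : n ≠ 0) : 0 < waveLength L n := by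
  have hL : 0 < L := Fact.out
  obtain ⟨i, hi⟩ := Function.ne_iff.1 hn
  have h : 0 < ∑ i, (n i : ℝ) ^ 2 := by
    refine Finset.sum_pos' (fun _ _ => sq_nonneg _) ⟨i, Finset.mem_univ _, ?_⟩
    have : (n i : ℝ) ≠ 0 := by exact_mod_cast hi
    positivity
  have := Real.sqrt_pos.2 h
  unfold waveLength
  positivity

omit [Fact (0 < L)] in
lemma waveLength_sq (n : Fin 3 → ℤ) :
    waveLength L n ^ 2 = (2 * Real.pi / L) ^ 2 * ∑ i, (n i : ℝ) ^ 2 := by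
  rw [waveLength, mul_pow, Real.sq_sqrt (by positivity)]

/-! ### Lattice sums -/

/-- The theta series `∑ exp (-π x n²)`. -/
def theta (x : ℝ) : ℝ := ∑' n : ℤ, Real.exp (-Real.pi * x * (n : ℝ) ^ 2)

lemma summable_theta {x : ℝ} (hx : 0 < x) :
    Summable fun n : ℤ => Real.exp (-Real.pi * x * (n : ℝ) ^ 2) := by
  have h := summable_pow_mul_jacobiTheta₂_term_bound 0 hx 0
  refine h.congr fun n => ?_
  simp only [pow_zero, one_mul]
  congr 1
  ring

/-- Since `π > 3` and `n² ≥ n`, the terms with `n ≥ 1` are dominated by the geometric series in `q =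
e^{-3x} ≤ 1/20`, and `2 / (1 - q) ≤ 22/10`. -/
lemma theta_le_of_one_le {x : ℝ} (hx : 1 ≤ x) : theta x ≤ 1 + 22 / 10 * Real.exp (-(3 * x)) := by
  set q := Real.exp (-(3 * x)) with hq
  have hq0 : 0 < q := Real.exp_pos _
  have hq1 : q ≤ 1 / 20 := by
    have h1 : Real.exp (-(3 * x)) ≤ Real.exp (-3) := Real.exp_le_exp.2 (by linarith)
    have h2 : Real.exp (-3) = (Real.exp 1 ^ 3)⁻¹ := by
      rw [← Real.exp_nat_mul, ← Real.exp_neg]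
      norm_num
    have h3 : (20 : ℝ) ≤ Real.exp 1 ^ 3 := by
      have := Real.exp_one_gt_d9
      calc (20 : ℝ) ≤ 2.7182818283 ^ 3 := by norm_num
        _ ≤ _ := by gcongr
    rw [h2] at h1
    refine h1.trans ?_
    rw [one_div]
    gcongr
  have hs := summable_theta (lt_of_lt_of_le one_pos hx)
  have hgeo : HasSum (fun n : ℕ => q ^ n * q) ((1 - q)⁻¹ * q) :=
    (hasSum_geometric_of_lt_one hq0.le (by linarith)).mul_right q
  have hle : ∀ n : ℕ, Real.exp (-Real.pi * x * (((n + 1 : ℕ) : ℤ) : ℝ) ^ 2) ≤ q ^ n * q := by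
    intro n
    rw [← pow_succ, hq, ← Real.exp_nat_mul]
    refine Real.exp_le_exp.2 ?_
    have hpi := Real.pi_gt_three
    push_cast
    have hn : (0 : ℝ) ≤ n := Nat.cast_nonneg n
    have h1 : 3 * x ≤ Real.pi * x := by nlinarith
    have h2 : (n : ℝ) + 1 ≤ (n + 1) ^ 2 := by nlinarith
    nlinarith [mul_le_mul h1 h2 (by linarith) (by nlinarith)]
  have hsum : Summable fun n : ℕ => Real.exp (-Real.pi * x * (((n + 1 : ℕ) : ℤ) : ℝ) ^ 2) :=
    hgeo.summable.of_nonneg_of_le (fun _ => (Real.exp_pos _).le) hle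
  have htail := hsum.tsum_le_tsum hle hgeo.summable
  rw [hgeo.tsum_eq] at htail
  have heq : theta x = 1 + 2 * ∑' n : ℕ, Real.exp (-Real.pi * x * (((n + 1 : ℕ) : ℤ) : ℝ) ^ 2) := by
    have he : Function.Even fun n : ℤ => Real.exp (-Real.pi * x * (n : ℝ) ^ 2) := fun n => by simp
    rw [theta, tsum_int_eq_zero_add_two_mul_tsum_pnat he hs,
      ← tsum_pnat_eq_tsum_succ (f := fun n : ℕ => Real.exp (-Real.pi * x * ((n : ℤ) : ℝ) ^ 2))]
    simp
  have h5 : (1 - q)⁻¹ * q ≤ 11 / 10 * q := by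
    gcongr
    rw [inv_le_comm₀ (by linarith) (by norm_num)]
    linarith
  linarith

lemma theta_nonneg (x : ℝ) : 0 ≤ theta x := tsum_nonneg fun _ => (Real.exp_pos _).le

lemma theta_cube_le_of_one_le {x : ℝ} (hx : 1 ≤ x) : theta x ^ 3 ≤ 1 + x ^ (-(3 / 2) : ℝ) := by
  have hx0 : 0 < x := by linarith
  set q := Real.exp (-(3 * x)) with hq
  have hq0 : 0 < q := Real.exp_pos _
  -- From `e^x ≥ e x` and `e³ ≥ 20`.
  have hqx : q * (20 * x ^ 3) ≤ 1 := by
    have h1 : Real.exp 1 * x ≤ Real.exp x := Real.exp_one_mul_le_exp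
    have h2 : (20 : ℝ) ≤ Real.exp 1 ^ 3 := by
      have := Real.exp_one_gt_d9
      calc (20 : ℝ) ≤ 2.7182818283 ^ 3 := by norm_num
        _ ≤ _ := by gcongr
    have h3 : 20 * x ^ 3 ≤ Real.exp (3 * x) := by
      calc 20 * x ^ 3 ≤ Real.exp 1 ^ 3 * x ^ 3 := by gcongr
        _ = (Real.exp 1 * x) ^ 3 := by ring
        _ ≤ Real.exp x ^ 3 := by gcongr
        _ = Real.exp (3 * x) := by rw [← Real.exp_nat_mul]; norm_num
    rw [hq, Real.exp_neg, inv_mul_le_iff₀ (Real.exp_pos _), mul_one]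
    exact h3
  have hq1 : q ≤ 1 / 20 := by
    have : (1 : ℝ) ≤ x ^ 3 := one_le_pow₀ hx
    nlinarith
  have hrp : 20 * q ≤ x ^ (-(3 / 2) : ℝ) := by
    have h1 : x ^ (-3 : ℝ) ≤ x ^ (-(3 / 2) : ℝ) := Real.rpow_le_rpow_of_exponent_le hx (by norm_num)
    have h2 : x ^ (-3 : ℝ) = (x ^ 3)⁻¹ := by
      rw [Real.rpow_neg hx0.le]
      norm_cast
    rw [h2] at h1
    refine le_trans ?_ h1
    rw [le_inv_comm₀ (by positivity) (by positivity), ← one_div, le_div_iff₀ (by positivity)]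
    linarith
  have h := theta_le_of_one_le hx
  calc theta x ^ 3 ≤ (1 + 22 / 10 * q) ^ 3 := pow_le_pow_left₀ (theta_nonneg x) h 3
    _ ≤ 1 + 20 * q := by nlinarith [mul_pos hq0 hq0, mul_pos hq0 (mul_pos hq0 hq0)]
    _ ≤ _ := by linarith

/-- The right-hand side obeys the same functional equation under `x ↦ 1/x` as the cube of the theta
series, so the case `x ≥ 1` suffices. -/
lemma theta_cube_le {x : ℝ} (hx : 0 < x) : theta x ^ 3 ≤ 1 + x ^ (-(3 / 2) : ℝ) := by
  rcases le_total 1 x with h | h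
  · exact theta_cube_le_of_one_le h
  have h1 : theta x = 1 / x ^ (1 / 2 : ℝ) * theta (1 / x) := by
    have := Real.tsum_exp_neg_mul_int_sq hx
    simpa only [theta, mul_one_div] using this
  have h2 := theta_cube_le_of_one_le (x := 1 / x) (by rwa [le_div_iff₀ hx, one_mul])
  have h3 : (1 / x ^ (1 / 2 : ℝ)) ^ 3 = x ^ (-(3 / 2) : ℝ) := by
    rw [one_div, ← Real.rpow_neg hx.le, ← Real.rpow_natCast, ← Real.rpow_mul hx.le]
    norm_num
  have h4 : x ^ (-(3 / 2) : ℝ) * (1 / x) ^ (-(3 / 2) : ℝ) = 1 := by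
    rw [← Real.mul_rpow hx.le (by positivity), mul_one_div_cancel hx.ne', Real.one_rpow]
  rw [h1, mul_pow, h3]
  calc _ ≤ x ^ (-(3 / 2) : ℝ) * (1 + (1 / x) ^ (-(3 / 2) : ℝ)) := by gcongr
    _ = _ := by rw [mul_add, h4]; ring

lemma tsum_prod_three {f : ℤ → ENNReal} :
    ∑' n : Fin 3 → ℤ, ∏ i, f (n i) = (∑' m, f m) ^ 3 := by
  have h (k : ℕ) : ∑' n : Fin k → ℤ, ∏ i, f (n i) = (∑' m, f m) ^ k := by
    induction k with
    | zero => simp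
    | succ k ih =>
      rw [← (Fin.consEquiv fun _ => ℤ).tsum_eq]
      simp only [Fin.prod_univ_succ, Fin.consEquiv, Equiv.coe_fn_mk, Fin.cons_zero, Fin.cons_succ]
      rw [ENNReal.tsum_prod (f := fun a (b : Fin k → ℤ) => f a * ∏ i, f (b i))]
      simp_rw [ENNReal.tsum_mul_left, ih, ENNReal.tsum_mul_right]
      rw [pow_succ']
  exact h 3

lemma tsum_exp_neg_lattice_le {x : ℝ} (hx : 0 < x) :
    ∑' n : Fin 3 → ℤ, (if n = 0 then 0 else
      ENNReal.ofReal (Real.exp (-(Real.pi * x * ∑ i, (n i : ℝ) ^ 2))))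
      ≤ ENNReal.ofReal (x ^ (-(3 / 2) : ℝ)) := by
  set F : (Fin 3 → ℤ) → ENNReal := fun n =>
    ENNReal.ofReal (Real.exp (-(Real.pi * x * ∑ i, (n i : ℝ) ^ 2))) with hF
  have hprod : ∑' n, F n = ENNReal.ofReal (theta x ^ 3) := by
    rw [ENNReal.ofReal_pow (theta_nonneg x), theta,
      ENNReal.ofReal_tsum_of_nonneg (fun _ => (Real.exp_pos _).le) (summable_theta hx),
      ← tsum_prod_three]
    refine tsum_congr fun n => ?_
    rw [hF, ← ENNReal.ofReal_prod_of_nonneg fun _ _ => (Real.exp_pos _).le, ← Real.exp_sum]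
    simp only [Finset.mul_sum, ← Finset.sum_neg_distrib, neg_mul]
  -- The term `n = 0` is exactly the `1` in `theta_cube_le`. Removing it, as zero mean allows,
  -- leaves a pure power of `x`, hence a bound with the scaling of the whole space.
  have hsplit : ∑' n, F n = F 0 + ∑' n, ite (n = 0) 0 (F n) :=
    ENNReal.summable.tsum_eq_add_tsum_ite' 0
  have h0 : F 0 = 1 := by simp [hF]
  have hle : 1 + ∑' n, ite (n = 0) 0 (F n) ≤ 1 + ENNReal.ofReal (x ^ (-(3 / 2) : ℝ)) := by
    rw [← h0, ← hsplit, h0, hprod, ← ENNReal.ofReal_one,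
      ← ENNReal.ofReal_add zero_le_one (by positivity)]
    exact ENNReal.ofReal_le_ofReal (theta_cube_le hx)
  exact (ENNReal.add_le_add_iff_left ENNReal.one_ne_top).1 hle

lemma forty_le_four_pi_rpow : (40 : ℝ) ≤ (4 * Real.pi) ^ (3 / 2 : ℝ) := by
  have hpi := Real.pi_gt_three
  have h : ((40 : ℝ) ^ 2) ^ (1 / 2 : ℝ) ≤ ((4 * Real.pi) ^ 3) ^ (1 / 2 : ℝ) := by
    refine Real.rpow_le_rpow (by norm_num) ?_ (by norm_num)
    calc (40 : ℝ) ^ 2 ≤ (4 * 3) ^ 3 := by norm_num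
      _ ≤ _ := by gcongr
  rw [← Real.rpow_natCast, ← Real.rpow_natCast, ← Real.rpow_mul (by norm_num),
    ← Real.rpow_mul (by positivity)] at h
  norm_num at h ⊢
  exact h

/-- Rescaling by `x = 4πτ/L²` gives `L³ (4πτ)^{-3/2}`, the value of the corresponding integral over
`ℝ³`; then `(4π)^{3/2} ≥ 40`. -/
lemma tsum_exp_waveLength_le {τ : ℝ} (hτ : 0 < τ) :
    ∑' n : Fin 3 → ℤ, (if n = 0 then 0 else ENNReal.ofReal (Real.exp (-(τ * waveLength L n ^ 2))))
      ≤ ENNReal.ofReal (L ^ 3 * (τ ^ (-(3 / 2) : ℝ) / 40)) := by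
  have hL : 0 < L := Fact.out
  have hpi := Real.pi_pos
  have h := tsum_exp_neg_lattice_le (x := 4 * Real.pi * τ / L ^ 2) (by positivity)
  calc _ = _ := by
        refine tsum_congr fun n => ?_
        rw [waveLength_sq]
        congr 3
        field_simp
        ring_nf
    _ ≤ _ := h
    _ ≤ _ := by
      refine ENNReal.ofReal_le_ofReal ?_
      have hL3 : (L ^ 2) ^ (-(3 / 2) : ℝ) = (L ^ 3)⁻¹ := by
        rw [← Real.rpow_natCast, ← Real.rpow_mul hL.le, ← Real.rpow_natCast, ← Real.rpow_neg hL.le]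
        norm_num
      rw [Real.div_rpow (by positivity) (by positivity), Real.mul_rpow (by positivity) hτ.le, hL3,
        div_inv_eq_mul, mul_comm, Real.rpow_neg (by positivity)]
      have := forty_le_four_pi_rpow
      rw [div_eq_inv_mul _ (40 : ℝ)]
      gcongr

lemma tsum_exp_waveLength_div_sq_le {τ : ℝ} (hτ : 0 < τ) :
    ∑' n : Fin 3 → ℤ, (if n = 0 then 0 else
      ENNReal.ofReal (Real.exp (-(τ * waveLength L n ^ 2)) / waveLength L n ^ 2))
      ≤ ENNReal.ofReal (L ^ 3 * (τ ^ (-(1 / 2) : ℝ) / 20)) := by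
  have hL : 0 < L := Fact.out
  -- Division by `|k|²` is integration of the Gaussian in time over `(τ, ∞)`.
  have hint (n : Fin 3 → ℤ) : (if n = 0 then 0 else
      ENNReal.ofReal (Real.exp (-(τ * waveLength L n ^ 2)) / waveLength L n ^ 2))
      = ∫⁻ u in Set.Ioi τ, (if n = 0 then 0 else
        ENNReal.ofReal (Real.exp (-(u * waveLength L n ^ 2)))) := by
    split_ifs with hn
    · simp
    have hk : -(waveLength L n ^ 2) < 0 := by
      have := waveLength_pos (L := L) hn
      simp only [Left.neg_neg_iff]
      positivity
    have h1 := integrableOn_exp_mul_Ioi hk τ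
    have h2 := integral_exp_mul_Ioi hk τ
    have h3 := ofReal_integral_eq_lintegral_ofReal h1
      (Filter.Eventually.of_forall fun _ => (Real.exp_pos _).le)
    rw [h2, neg_div_neg_eq] at h3
    convert h3 using 3 <;> ring_nf
  have hmono : ∫⁻ u in Set.Ioi τ, ∑' n : Fin 3 → ℤ, (if n = 0 then 0 else
        ENNReal.ofReal (Real.exp (-(u * waveLength L n ^ 2))))
      ≤ ∫⁻ u in Set.Ioi τ, ENNReal.ofReal (L ^ 3 * (u ^ (-(3 / 2) : ℝ) / 40)) :=
    setLIntegral_mono' measurableSet_Ioi fun u hu => tsum_exp_waveLength_le (hτ.trans hu)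
  simp_rw [hint]
  rw [← lintegral_tsum]
  · refine hmono.trans (le_of_eq ?_)
    have h1 : IntegrableOn (fun u : ℝ => u ^ (-(3 / 2) : ℝ)) (Set.Ioi τ) :=
      integrableOn_Ioi_rpow_of_lt (by norm_num) hτ
    have h2 := integral_Ioi_rpow_of_lt (a := -(3 / 2)) (by norm_num) hτ
    rw [← ofReal_integral_eq_lintegral_ofReal ((h1.div_const 40).const_mul (L ^ 3)),
      integral_const_mul, integral_div, h2]
    · congr 2
      norm_num
      ring
    · refine (ae_restrict_iff' measurableSet_Ioi).2 (Filter.Eventually.of_forall fun u hu => ?_)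
      have : 0 < u := hτ.trans hu
      simp only [Pi.zero_apply]
      positivity
  · intro n
    split_ifs
    · fun_prop
    · fun_prop

lemma tsum_exp_waveLength_div_le {τ : ℝ} (hτ : 0 < τ) :
    ∑' n : Fin 3 → ℤ, (if n = 0 then 0 else
      ENNReal.ofReal (Real.exp (-(τ * waveLength L n ^ 2)) / waveLength L n))
      ≤ ENNReal.ofReal (L ^ 3 * (3 / 80 / τ)) := by
  have hL : 0 < L := Fact.out
  have hs : 0 < Real.sqrt τ := Real.sqrt_pos.2 hτ
  have hss : Real.sqrt τ ^ 2 = τ := Real.sq_sqrt hτ.le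
  have h1 : τ ^ (-(3 / 2) : ℝ) = (Real.sqrt τ ^ 3)⁻¹ := by
    rw [Real.sqrt_eq_rpow, ← Real.rpow_natCast, ← Real.rpow_mul hτ.le, ← Real.rpow_neg hτ.le]
    norm_num
  have h2 : τ ^ (-(1 / 2) : ℝ) = (Real.sqrt τ)⁻¹ := by
    rw [Real.sqrt_eq_rpow, ← Real.rpow_neg hτ.le]
  calc _ ≤ ∑' n : Fin 3 → ℤ, (ENNReal.ofReal (Real.sqrt τ / 2) * (if n = 0 then 0 else
          ENNReal.ofReal (Real.exp (-(τ * waveLength L n ^ 2))))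
        + ENNReal.ofReal (1 / (2 * Real.sqrt τ)) * (if n = 0 then 0 else
          ENNReal.ofReal (Real.exp (-(τ * waveLength L n ^ 2)) / waveLength L n ^ 2))) := by
        refine ENNReal.tsum_le_tsum fun n => ?_
        split_ifs with hn
        · simp
        have hk := waveLength_pos (L := L) hn
        rw [← ENNReal.ofReal_mul (by positivity), ← ENNReal.ofReal_mul (by positivity),
          ← ENNReal.ofReal_add (by positivity) (by positivity)]
        refine ENNReal.ofReal_le_ofReal ?_
        set e := Real.exp (-(τ * waveLength L n ^ 2))
        have he : 0 < e := Real.exp_pos _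
        -- AM–GM interpolates between the two previous sums; the weights `√τ` and `1/√τ` make both
        -- contributions of order `1/τ`, with `1/80 + 1/40 = 3/80`.
        have h3 : 1 / waveLength L n ≤
            Real.sqrt τ / 2 + 1 / (2 * Real.sqrt τ) * (1 / waveLength L n ^ 2) := by
          have h4 : Real.sqrt τ / 2 + 1 / (2 * Real.sqrt τ) * (1 / waveLength L n ^ 2)
              - 1 / waveLength L n
              = (Real.sqrt τ - 1 / waveLength L n) ^ 2 / (2 * Real.sqrt τ) := by
            field_simp
            ring
          have h5 : 0 ≤ (Real.sqrt τ - 1 / waveLength L n) ^ 2 / (2 * Real.sqrt τ) := by positivity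
          linarith
        have := mul_le_mul_of_nonneg_left h3 he.le
        calc e / waveLength L n = e * (1 / waveLength L n) := by ring
          _ ≤ _ := this
          _ = _ := by ring
    _ ≤ ENNReal.ofReal (Real.sqrt τ / 2) * ENNReal.ofReal (L ^ 3 * (τ ^ (-(3 / 2) : ℝ) / 40))
        + ENNReal.ofReal (1 / (2 * Real.sqrt τ)) *
          ENNReal.ofReal (L ^ 3 * (τ ^ (-(1 / 2) : ℝ) / 20)) := by
        rw [ENNReal.tsum_add, ENNReal.tsum_mul_left, ENNReal.tsum_mul_left]
        gcongr
        · exact tsum_exp_waveLength_le hτ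
        · exact tsum_exp_waveLength_div_sq_le hτ
    _ = _ := by
        rw [← ENNReal.ofReal_mul (by positivity), ← ENNReal.ofReal_mul (by positivity),
          ← ENNReal.ofReal_add (by positivity) (by positivity), h1, h2]
        congr 1
        rw [← hss]
        field_simp
        simp only [hss]
        ring

/-! ### Layer-cake integrals -/

lemma intervalIntegral_pow_mul_sub_sq (m : ℕ) (v : ℝ) :
    ∫ l in (0 : ℝ)..v, l ^ m * (v - l) ^ 2 = 2 / ((m + 1) * (m + 2) * (m + 3)) * v ^ (m + 3) := by
  have h : ∀ l : ℝ, l ^ m * (v - l) ^ 2 = v ^ 2 * l ^ m - 2 * v * l ^ (m + 1) + l ^ (m + 2) :=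
    fun l => by ring
  simp_rw [h]
  rw [intervalIntegral.integral_add, intervalIntegral.integral_sub,
    intervalIntegral.integral_const_mul, intervalIntegral.integral_const_mul, integral_pow,
    integral_pow, integral_pow]
  · have h1 : (m : ℝ) + 1 ≠ 0 := by positivity
    have h2 : (m : ℝ) + 2 ≠ 0 := by positivity
    have h3 : (m : ℝ) + 3 ≠ 0 := by positivity
    have h4 : (m : ℝ) + 1 + 1 ≠ 0 := by positivity
    have h5 : (m : ℝ) + 2 + 1 ≠ 0 := by positivity
    push_cast
    field_simp
    ring
  all_goals exact Continuous.intervalIntegrable (by fun_prop) _ _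

lemma lintegral_pow_mul_ofReal_sub_sq (m : ℕ) {v : ℝ} (hv : 0 ≤ v) :
    ∫⁻ l in Set.Ioi (0 : ℝ), ENNReal.ofReal (l ^ m) * ENNReal.ofReal (v - l) ^ 2
      = ENNReal.ofReal (2 / ((m + 1) * (m + 2) * (m + 3)) * v ^ (m + 3)) := by
  rw [← intervalIntegral_pow_mul_sub_sq, intervalIntegral.integral_of_le hv,
    ofReal_integral_eq_lintegral_ofReal, ← Set.Ioc_union_Ioi_eq_Ioi hv,
    lintegral_union measurableSet_Ioi (Set.Ioc_disjoint_Ioi le_rfl)]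
  · have h1 : ∫⁻ l in Set.Ioi v, ENNReal.ofReal (l ^ m) * ENNReal.ofReal (v - l) ^ 2 = 0 := by
      rw [setLIntegral_congr_fun (g := fun _ => 0) measurableSet_Ioi, lintegral_zero]
      intro l hl
      simp [ENNReal.ofReal_of_nonpos (sub_nonpos.2 (le_of_lt hl))]
    rw [h1, add_zero]
    refine setLIntegral_congr_fun measurableSet_Ioc fun l hl => ?_
    have := hl.1.le
    have := sub_nonneg.2 hl.2
    rw [← ENNReal.ofReal_pow this, ← ENNReal.ofReal_mul (by positivity)]
  · exact (Continuous.intervalIntegrable (by fun_prop) 0 v).1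
  · refine (ae_restrict_iff' measurableSet_Ioc).2 (Filter.Eventually.of_forall fun l hl => ?_)
    have := hl.1.le
    simp only [Pi.zero_apply]
    positivity

lemma lintegral_pow_mul_min_le {m q : ℕ} (hq : m + 1 < q) {b : ℝ} (hb : 0 < b) :
    ∫⁻ l in Set.Ioi (0 : ℝ), ENNReal.ofReal (l ^ m * min 1 ((b / l) ^ q))
      ≤ ENNReal.ofReal ((1 / (m + 1) + 1 / ((q : ℝ) - m - 1)) * b ^ (m + 1)) := by
  have hq' : (0 : ℝ) < (q : ℝ) - m - 1 := by
    have : (m : ℝ) + 1 < q := by exact_mod_cast hq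
    linarith
  have h1 : ∫⁻ l in Set.Ioc 0 b, ENNReal.ofReal (l ^ m * min 1 ((b / l) ^ q))
      ≤ ENNReal.ofReal (1 / (m + 1) * b ^ (m + 1)) := by
    have h2 : ∫ l in (0 : ℝ)..b, l ^ m = 1 / (m + 1) * b ^ (m + 1) := by
      rw [integral_pow]
      simp
      ring
    rw [← h2, intervalIntegral.integral_of_le hb.le, ofReal_integral_eq_lintegral_ofReal]
    · refine setLIntegral_mono' measurableSet_Ioc fun l hl => ENNReal.ofReal_le_ofReal ?_
      have := hl.1.le
      exact mul_le_of_le_one_right (by positivity) (min_le_left _ _)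
    · exact (Continuous.intervalIntegrable (by fun_prop) 0 b).1
    · refine (ae_restrict_iff' measurableSet_Ioc).2 (Filter.Eventually.of_forall fun l hl => ?_)
      have := hl.1.le
      simp only [Pi.zero_apply]
      positivity
  have h3 : ∫⁻ l in Set.Ioi b, ENNReal.ofReal (l ^ m * min 1 ((b / l) ^ q))
      ≤ ENNReal.ofReal (1 / ((q : ℝ) - m - 1) * b ^ (m + 1)) := by
    have hlt : (m : ℝ) - q < -1 := by linarith
    have h2 : ∫ l in Set.Ioi b, b ^ q * l ^ ((m : ℝ) - q) = 1 / ((q : ℝ) - m - 1) * b ^ (m + 1) := by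
      have h4 : b ^ (m + 1) = b ^ q * b ^ ((m : ℝ) - q + 1) := by
        rw [← Real.rpow_natCast, ← Real.rpow_natCast, ← Real.rpow_add hb]
        congr 1
        push_cast
        ring
      have h5 : (m : ℝ) - q + 1 = -((q : ℝ) - m - 1) := by ring
      rw [integral_const_mul, integral_Ioi_rpow_of_lt hlt hb, h4, h5, neg_div_neg_eq]
      ring
    rw [← h2, ofReal_integral_eq_lintegral_ofReal]
    · refine setLIntegral_mono' measurableSet_Ioi fun l hl => ENNReal.ofReal_le_ofReal ?_
      have hl0 : 0 < l := hb.trans hl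
      rw [Real.rpow_sub hl0, Real.rpow_natCast, Real.rpow_natCast]
      calc l ^ m * min 1 ((b / l) ^ q) ≤ l ^ m * (b / l) ^ q := by
            gcongr
            exact min_le_right _ _
        _ = _ := by rw [div_pow]; ring
    · exact (integrableOn_Ioi_rpow_of_lt hlt hb).const_mul _
    · refine (ae_restrict_iff' measurableSet_Ioi).2 (Filter.Eventually.of_forall fun l hl => ?_)
      have : 0 < l := hb.trans hl
      simp only [Pi.zero_apply]
      positivity
  rw [← Set.Ioc_union_Ioi_eq_Ioi hb.le, lintegral_union measurableSet_Ioi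
    (Set.Ioc_disjoint_Ioi le_rfl), add_mul, ENNReal.ofReal_add (by positivity) (by positivity)]
  exact add_le_add h1 h3

/-! ### Truncation by the heat flow -/

lemma lintegral_enorm_sq (w : L2Field L) : ∫⁻ x, ‖w x‖ₑ ^ 2 = ENNReal.ofReal (‖w‖ ^ 2) := by
  rw [ENNReal.ofReal_pow (norm_nonneg _), ofReal_norm, Lp.enorm_def,
    eLpNorm_eq_lintegral_rpow_enorm_toReal two_ne_zero ENNReal.ofNat_ne_top, ← ENNReal.rpow_natCast,
    ← ENNReal.rpow_mul]
  norm_num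

lemma ae_norm_sum_mode_le (F : Finset (Fin 3 → ℤ)) (a : (Fin 3 → ℤ) → Vec) :
    ∀ᵐ x, ‖(∑ n ∈ F, mode L n (a n)) x‖ ≤ ∑ n ∈ F, ‖a n‖ := by
  have h : ∑ n ∈ F, mode L n (a n) =
      ContinuousMap.toLp (E := Vec) 2 (volume : Measure (Torus L)) ℂ (∑ n ∈ F, modeFun L n (a n)) := by
    rw [map_sum]
    rfl
  rw [h]
  filter_upwards [ContinuousMap.coeFn_toLp (p := 2) (𝕜 := ℂ) (volume : Measure (Torus L))
    (∑ n ∈ F, modeFun L n (a n))] with x hx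
  rw [hx, ContinuousMap.sum_apply]
  refine (norm_sum_le _ _).trans (Finset.sum_le_sum fun n _ => ?_)
  simp [modeFun, norm_smul, norm_expMode]

/-- The multiplied field is bounded by `l`, so the excess of `|w|` over `l` is carried by the
remainder with symbol `1 - c n`. The pointwise bound is used only for finite partial sums, and the
limit is taken in `L²`. -/
lemma HasSeries.lintegral_sub_sq_le {w : L2Field L} {a : (Fin 3 → ℤ) → Vec} (hw : HasSeries w a)
    {c : (Fin 3 → ℤ) → ℝ} (hc : ∀ n, |c n| ≤ 1) {l : ℝ} (hl : 0 ≤ l)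
    (hcl : ∑' n, ENNReal.ofReal (|c n| * ‖a n‖) ≤ ENNReal.ofReal l) :
    ∫⁻ x, ENNReal.ofReal (‖w x‖ - l) ^ 2
      ≤ ∑' n, ENNReal.ofReal (L ^ 3 * ((1 - c n) ^ 2 * ‖a n‖ ^ 2)) := by
  have hL : 0 < L := Fact.out
  obtain ⟨v, hv⟩ := exists_hasSeries (L := L) (summable_norm_sq_smul hw.summable_norm_sq hc)
  have hF (F : Finset (Fin 3 → ℤ)) : ∫⁻ x, ENNReal.ofReal (‖w x‖ - l) ^ 2
      ≤ ENNReal.ofReal (‖w - ∑ n ∈ F, mode L n (c n • a n)‖ ^ 2) := by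
    rw [← lintegral_enorm_sq]
    refine lintegral_mono_ae ?_
    filter_upwards [ae_norm_sum_mode_le (L := L) F (fun n => c n • a n),
      Lp.coeFn_sub w (∑ n ∈ F, mode L n (c n • a n))] with x h1 h2
    have h3 : ∑ n ∈ F, ‖c n • a n‖ ≤ l := by
      rw [← ENNReal.ofReal_le_ofReal_iff hl, ENNReal.ofReal_sum_of_nonneg fun _ _ => norm_nonneg _]
      simp_rw [norm_smul, Real.norm_eq_abs]
      exact (ENNReal.sum_le_tsum F).trans hcl
    rw [h2, ← ofReal_norm, Pi.sub_apply]
    gcongr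
    have := norm_sub_norm_le (w x) ((∑ n ∈ F, mode L n (c n • a n)) x)
    linarith
  have hlim : Filter.Tendsto
      (fun F : Finset (Fin 3 → ℤ) => ENNReal.ofReal (‖w - ∑ n ∈ F, mode L n (c n • a n)‖ ^ 2))
      Filter.atTop (nhds (ENNReal.ofReal (‖w - v‖ ^ 2))) :=
    ENNReal.tendsto_ofReal (((tendsto_const_nhds.sub hv).norm).pow 2)
  refine (ge_of_tendsto' hlim hF).trans (le_of_eq ?_)
  have hsum := (hw.sub hv).hasSum_norm_sq
  rw [← hsum.tsum_eq, ENNReal.ofReal_tsum_of_nonneg (fun _ => by positivity) hsum.summable]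
  refine tsum_congr fun n => ?_
  have : a n - c n • a n = (1 - c n) • a n := by rw [sub_smul, one_smul]
  rw [this, norm_smul, mul_pow, Real.norm_eq_abs, sq_abs]

lemma one_sub_exp_neg_sq_le {u : ℝ} (hu : 0 ≤ u) : (1 - Real.exp (-u)) ^ 2 ≤ min 1 (u ^ 2) := by
  have h1 : 0 < Real.exp (-u) := Real.exp_pos _
  have h2 : Real.exp (-u) ≤ 1 := Real.exp_le_one_iff.2 (by linarith)
  have h3 : 1 - u ≤ Real.exp (-u) := Real.one_sub_le_exp_neg u
  refine le_min (by nlinarith) (pow_le_pow_left₀ (by linarith) (by linarith) 2)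

/-- The truncation argument, with heat time `T / l^r` at level `l`; `hlow` says that this time
suffices. With `b^r = T|k|²` the remainder at `k` is at most `min 1 ((b/l)^{2r})`, and integration
against `l^m` yields the weight `b^{m+1}`. The case `m = 3`, `r = 4` produces `|k|²`, and `m = 0`,
`r = 2` produces `|k|`. -/
lemma HasSeries.lintegral_pow_le {w : L2Field L} {a : (Fin 3 → ℤ) → Vec} (hw : HasSeries w a)
    (ha : a 0 = 0) {m r : ℕ} (hmr : m + 1 < r * 2) {T : ℝ} (hT : 0 < T) {b : (Fin 3 → ℤ) → ℝ}
    (hb0 : ∀ n ≠ 0, 0 < b n) (hb : ∀ n, b n ^ r = T * waveLength L n ^ 2)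
    (hlow : ∀ l : ℝ, 0 < l →
      ∑' n, ENNReal.ofReal (Real.exp (-(T / l ^ r * waveLength L n ^ 2)) * ‖a n‖)
        ≤ ENNReal.ofReal l) :
    ENNReal.ofReal (2 / ((m + 1) * (m + 2) * (m + 3))) * ∫⁻ x, ‖w x‖ₑ ^ (m + 3)
      ≤ ENNReal.ofReal (1 / (m + 1) + 1 / ((r : ℝ) * 2 - m - 1)) *
        ∑' n, ENNReal.ofReal (L ^ 3 * (b n ^ (m + 1) * ‖a n‖ ^ 2)) := by
  have hL : 0 < L := Fact.out
  have hpos : (0 : ℝ) < (r : ℝ) * 2 - m - 1 := by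
    have : (m : ℝ) + 1 < r * 2 := by exact_mod_cast hmr
    linarith
  have hmeas : Measurable fun x => w x := (Lp.stronglyMeasurable w).measurable
  calc ENNReal.ofReal (2 / ((m + 1) * (m + 2) * (m + 3))) * ∫⁻ x, ‖w x‖ₑ ^ (m + 3)
      = ∫⁻ x, ∫⁻ l in Set.Ioi (0 : ℝ),
          ENNReal.ofReal (l ^ m) * ENNReal.ofReal (‖w x‖ - l) ^ 2 := by
        rw [← lintegral_const_mul _ (by fun_prop)]
        refine lintegral_congr fun x => ?_
        rw [lintegral_pow_mul_ofReal_sub_sq m (norm_nonneg _), ENNReal.ofReal_mul (by positivity),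
          ENNReal.ofReal_pow (norm_nonneg _), ofReal_norm]
    _ = ∫⁻ l in Set.Ioi (0 : ℝ), ∫⁻ x,
          ENNReal.ofReal (l ^ m) * ENNReal.ofReal (‖w x‖ - l) ^ 2 := by
        refine lintegral_lintegral_swap (Measurable.aemeasurable ?_)
        have : Measurable fun z : Torus L × ℝ => w z.1 := hmeas.comp measurable_fst
        unfold Function.uncurry
        fun_prop
    _ ≤ ∫⁻ l in Set.Ioi (0 : ℝ), ∑' n, ENNReal.ofReal (L ^ 3 * ‖a n‖ ^ 2) *
          ENNReal.ofReal (l ^ m * min 1 ((b n / l) ^ (r * 2))) := by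
        refine setLIntegral_mono' measurableSet_Ioi fun l hl => ?_
        have hl : 0 < l := hl
        rw [lintegral_const_mul _ (by fun_prop)]
        have hexp (n : Fin 3 → ℤ) : |Real.exp (-(T / l ^ r * waveLength L n ^ 2))|
            = Real.exp (-(T / l ^ r * waveLength L n ^ 2)) := abs_of_pos (Real.exp_pos _)
        have hle := hw.lintegral_sub_sq_le
          (c := fun n => Real.exp (-(T / l ^ r * waveLength L n ^ 2)))
          (fun n => by
            rw [hexp]
            refine Real.exp_le_one_iff.2 (neg_nonpos.2 ?_)
            positivity) hl.le
          (by simp_rw [hexp]; exact hlow l hl)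
        refine (mul_le_mul_right hle _).trans ?_
        rw [← ENNReal.tsum_mul_left]
        refine ENNReal.tsum_le_tsum fun n => ?_
        rw [← ENNReal.ofReal_mul (by positivity), ← ENNReal.ofReal_mul (by positivity)]
        refine ENNReal.ofReal_le_ofReal ?_
        have h1 := one_sub_exp_neg_sq_le (u := T / l ^ r * waveLength L n ^ 2) (by positivity)
        have h2 : (T / l ^ r * waveLength L n ^ 2) ^ 2 = (b n / l) ^ (r * 2) := by
          rw [pow_mul, div_pow, hb]
          ring
        rw [h2] at h1
        calc _ ≤ l ^ m * (L ^ 3 * (min 1 ((b n / l) ^ (r * 2)) * ‖a n‖ ^ 2)) := by gcongr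
          _ = _ := by ring
    _ = ∑' n, ENNReal.ofReal (L ^ 3 * ‖a n‖ ^ 2) * ∫⁻ l in Set.Ioi (0 : ℝ),
          ENNReal.ofReal (l ^ m * min 1 ((b n / l) ^ (r * 2))) := by
        rw [lintegral_tsum fun n => Measurable.aemeasurable (by fun_prop)]
        refine tsum_congr fun n => lintegral_const_mul _ (by fun_prop)
    _ ≤ _ := by
        rw [← ENNReal.tsum_mul_left]
        refine ENNReal.tsum_le_tsum fun n => ?_
        rcases eq_or_ne n 0 with rfl | hn
        · simp [ha]
        refine (mul_le_mul_right (lintegral_pow_mul_min_le hmr (hb0 n hn)) _).trans (le_of_eq ?_)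
        have := hb0 n hn
        push_cast
        rw [← ENNReal.ofReal_mul (by positivity), ← ENNReal.ofReal_mul (by positivity)]
        congr 1
        ring

/-! ### Sobolev inequalities -/

/-- Cauchy–Schwarz in the form of Young's inequality, with weights chosen so that each half
contributes `l/2`. This keeps all sums in `ENNReal`, where no summability is required. -/
lemma tsum_mul_norm_le {a : (Fin 3 → ℤ) → Vec} (ha : a 0 = 0) {g e : (Fin 3 → ℤ) → ℝ}
    (hg : ∀ n ≠ 0, 0 < g n) {h E l : ℝ} (hh : 0 < h) (hl : 0 < l)
    (hsum : ∑' n, ENNReal.ofReal (L ^ 3 * (g n * ‖a n‖ ^ 2)) ≤ ENNReal.ofReal (h ^ 2))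
    (hE : ∑' n, (if n = 0 then 0 else ENNReal.ofReal (e n ^ 2 / g n)) ≤ ENNReal.ofReal (L ^ 3 * E))
    (hEl : h ^ 2 * E ≤ l ^ 2) :
    ∑' n, ENNReal.ofReal (e n * ‖a n‖) ≤ ENNReal.ofReal l := by
  have hL : 0 < L := Fact.out
  have hc : 0 ≤ l / (2 * h ^ 2) := by positivity
  have hd : 0 ≤ h ^ 2 / (2 * l * L ^ 3) := by positivity
  calc ∑' n, ENNReal.ofReal (e n * ‖a n‖)
      ≤ ∑' n, (ENNReal.ofReal (l / (2 * h ^ 2)) * ENNReal.ofReal (L ^ 3 * (g n * ‖a n‖ ^ 2))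
        + ENNReal.ofReal (h ^ 2 / (2 * l * L ^ 3)) *
          (if n = 0 then 0 else ENNReal.ofReal (e n ^ 2 / g n))) := by
        refine ENNReal.tsum_le_tsum fun n => ?_
        split_ifs with hn
        · simp [hn, ha]
        have hgn := hg n hn
        rw [← ENNReal.ofReal_mul hc, ← ENNReal.ofReal_mul hd,
          ← ENNReal.ofReal_add (by positivity) (by positivity)]
        refine ENNReal.ofReal_le_ofReal ?_
        have h1 : l / (2 * h ^ 2) * (L ^ 3 * (g n * ‖a n‖ ^ 2))
            + h ^ 2 / (2 * l * L ^ 3) * (e n ^ 2 / g n) - e n * ‖a n‖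
            = (L ^ 3 * l * g n * ‖a n‖ - h ^ 2 * e n) ^ 2 / (2 * h ^ 2 * l * L ^ 3 * g n) := by
          field_simp
          ring
        have h2 : 0 ≤ (L ^ 3 * l * g n * ‖a n‖ - h ^ 2 * e n) ^ 2
            / (2 * h ^ 2 * l * L ^ 3 * g n) := by positivity
        linarith
    _ ≤ ENNReal.ofReal (l / (2 * h ^ 2)) * ENNReal.ofReal (h ^ 2)
        + ENNReal.ofReal (h ^ 2 / (2 * l * L ^ 3)) * ENNReal.ofReal (L ^ 3 * (l ^ 2 / h ^ 2)) := by
        rw [ENNReal.tsum_add, ENNReal.tsum_mul_left, ENNReal.tsum_mul_left]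
        gcongr
        refine hE.trans (ENNReal.ofReal_le_ofReal ?_)
        gcongr
        rwa [le_div_iff₀ (by positivity), mul_comm]
    _ = ENNReal.ofReal l := by
        rw [← ENNReal.ofReal_mul hc, ← ENNReal.ofReal_mul hd,
          ← ENNReal.ofReal_add (by positivity) (by positivity)]
        congr 1
        field_simp
        ring

lemma eLpNorm_le_of_lintegral_pow_le {w : L2Field L} {q : ℕ} (hq : q ≠ 0) {C : ℝ} (hC : 0 ≤ C)
    (h : ∫⁻ x, ‖w x‖ₑ ^ q ≤ ENNReal.ofReal (C ^ q)) :
    eLpNorm w (ENNReal.ofReal q) volume ≤ ENNReal.ofReal C := by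
  have hq' : (q : ℝ) ≠ 0 := by exact_mod_cast hq
  rw [ENNReal.ofReal_natCast, eLpNorm_eq_lintegral_rpow_enorm_toReal (by exact_mod_cast hq)
    (ENNReal.natCast_ne_top q), ENNReal.toReal_natCast]
  simp_rw [ENNReal.rpow_natCast]
  calc _ ≤ ENNReal.ofReal (C ^ q) ^ (1 / (q : ℝ)) := by gcongr
    _ = _ := by
      rw [ENNReal.ofReal_pow hC, ← ENNReal.rpow_natCast, ← ENNReal.rpow_mul,
        mul_one_div_cancel hq', ENNReal.rpow_one]

lemma HasSeries.eq_zero_of_tsum_le {w : L2Field L} {a : (Fin 3 → ℤ) → Vec} (hw : HasSeries w a)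
    (ha : a 0 = 0) {g : (Fin 3 → ℤ) → ℝ} (hg : ∀ n ≠ 0, 0 < g n)
    (h : ∑' n, ENNReal.ofReal (L ^ 3 * (g n * ‖a n‖ ^ 2)) ≤ 0) : w = 0 := by
  have hL : 0 < L := Fact.out
  refine hw.eq_zero fun n => ?_
  rcases eq_or_ne n 0 with rfl | hn
  · exact ha
  have h1 := ENNReal.tsum_eq_zero.1 (le_antisymm h zero_le) n
  rw [ENNReal.ofReal_eq_zero] at h1
  have hgn := hg n hn
  by_contra h2
  have h3 : 0 < ‖a n‖ := norm_pos_iff.2 h2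
  have : 0 < L ^ 3 * (g n * ‖a n‖ ^ 2) := by positivity
  linarith

lemma HasSeries.lintegral_pow_six_le {w : L2Field L} {a : (Fin 3 → ℤ) → Vec} (hw : HasSeries w a)
    (ha : a 0 = 0) {h : ℝ} (hh : 0 ≤ h)
    (hsum : ∑' n, ENNReal.ofReal (L ^ 3 * (waveLength L n ^ 2 * ‖a n‖ ^ 2))
      ≤ ENNReal.ofReal (h ^ 2)) :
    ∫⁻ x, ‖w x‖ₑ ^ 6 ≤ ENNReal.ofReal ((3 / 5 * h) ^ 6) := by
  have hL : 0 < L := Fact.out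
  have hg : ∀ n : Fin 3 → ℤ, n ≠ 0 → 0 < waveLength L n ^ 2 := fun n hn => by
    have := waveLength_pos (L := L) hn
    positivity
  -- The case `h = 0` is separate because the heat time below must be positive.
  rcases hh.eq_or_lt with rfl | hh
  · have : w = 0 := hw.eq_zero_of_tsum_le ha hg (by simpa using hsum)
    simp [this]
  -- The value for which the hypothesis `h² E ≤ l²` of `tsum_mul_norm_le` is an equality.
  set T : ℝ := h ^ 4 / 800 with hT
  have hT0 : 0 < T := by positivity
  have key := hw.lintegral_pow_le ha (m := 3) (r := 4) (by norm_num) hT0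
    (b := fun n => (T * waveLength L n ^ 2) ^ (1 / 4 : ℝ))
    (fun n hn => by have := hg n hn; positivity)
    (fun n => by
      rw [← Real.rpow_natCast, ← Real.rpow_mul (by positivity)]
      norm_num)
    (fun l hl => by
      have h1 := tsum_exp_waveLength_div_sq_le (L := L) (τ := 2 * (T / l ^ 4)) (by positivity)
      refine tsum_mul_norm_le ha hg hh hl hsum
        (E := (2 * (T / l ^ 4)) ^ (-(1 / 2) : ℝ) / 20) ?_ (le_of_eq ?_)
      · refine le_trans (le_of_eq (tsum_congr fun n => ?_)) h1
        rw [← Real.exp_nat_mul]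
        push_cast
        ring_nf
      · have h2 : 2 * (T / l ^ 4) = (h ^ 2 / (20 * l ^ 2)) ^ 2 := by
          rw [hT]
          field_simp
          ring
        rw [h2, Real.rpow_neg (by positivity), ← Real.sqrt_eq_rpow, Real.sqrt_sq (by positivity)]
        field_simp)
  have h1 (n : Fin 3 → ℤ) : ((T * waveLength L n ^ 2) ^ (1 / 4 : ℝ)) ^ (3 + 1)
      = T * waveLength L n ^ 2 := by
    rw [← Real.rpow_natCast, ← Real.rpow_mul (by positivity)]
    norm_num
  have h2 : ∑' n, ENNReal.ofReal (L ^ 3 * (((T * waveLength L n ^ 2) ^ (1 / 4 : ℝ)) ^ (3 + 1)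
      * ‖a n‖ ^ 2)) ≤ ENNReal.ofReal (T * h ^ 2) := by
    rw [ENNReal.ofReal_mul hT0.le]
    refine le_trans (le_of_eq ?_) (mul_le_mul_right hsum _)
    rw [← ENNReal.tsum_mul_left]
    refine tsum_congr fun n => ?_
    rw [h1, ← ENNReal.ofReal_mul hT0.le]
    congr 1
    ring
  have h3 := key.trans (mul_le_mul_right h2 _)
  rw [← ENNReal.ofReal_mul (by norm_num)] at h3
  calc ∫⁻ x, ‖w x‖ₑ ^ 6 = ENNReal.ofReal 60 * (ENNReal.ofReal (1 / 60) * ∫⁻ x, ‖w x‖ₑ ^ 6) := by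
        rw [← mul_assoc, ← ENNReal.ofReal_mul (by norm_num)]
        norm_num
    _ ≤ ENNReal.ofReal 60 * ENNReal.ofReal (1 / 2 * (T * h ^ 2)) := by
        gcongr
        norm_num at h3 ⊢
        exact h3
    -- The numerical claim is `30/800 ≤ (3/5)^6`.
    _ ≤ _ := by
        rw [← ENNReal.ofReal_mul (by norm_num)]
        refine ENNReal.ofReal_le_ofReal ?_
        rw [hT, mul_pow]
        have : 0 < h ^ 6 := by positivity
        nlinarith

lemma HasSeries.lintegral_pow_three_le {w : L2Field L} {a : (Fin 3 → ℤ) → Vec} (hw : HasSeries w a)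
    (ha : a 0 = 0) {h : ℝ} (hh : 0 ≤ h)
    (hsum : ∑' n, ENNReal.ofReal (L ^ 3 * (waveLength L n * ‖a n‖ ^ 2)) ≤ ENNReal.ofReal (h ^ 2)) :
    ∫⁻ x, ‖w x‖ₑ ^ 3 ≤ ENNReal.ofReal ((5 / 6 * h) ^ 3) := by
  have hL : 0 < L := Fact.out
  have hg : ∀ n : Fin 3 → ℤ, n ≠ 0 → 0 < waveLength L n := fun n hn => waveLength_pos hn
  rcases hh.eq_or_lt with rfl | hh
  · have : w = 0 := hw.eq_zero_of_tsum_le ha hg (by simpa using hsum)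
    simp [this]
  -- Again the value giving equality in `h² E ≤ l²`.
  set T : ℝ := 3 * h ^ 2 / 160 with hT
  have hT0 : 0 < T := by positivity
  have key := hw.lintegral_pow_le ha (m := 0) (r := 2) (by norm_num) hT0
    (b := fun n => Real.sqrt T * waveLength L n)
    (fun n hn => by have := hg n hn; positivity)
    (fun n => by rw [mul_pow, Real.sq_sqrt hT0.le])
    (fun l hl => by
      have h1 := tsum_exp_waveLength_div_le (L := L) (τ := 2 * (T / l ^ 2)) (by positivity)
      refine tsum_mul_norm_le ha hg hh hl hsum
        (E := 3 / 80 / (2 * (T / l ^ 2))) ?_ (le_of_eq ?_)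
      · refine le_trans (le_of_eq (tsum_congr fun n => ?_)) h1
        rw [← Real.exp_nat_mul]
        push_cast
        ring_nf
      · rw [hT]
        field_simp
        norm_num)
  -- Here `125/864 = (5/6)³ / 4`, since the integral is bounded by `4 √T h²`.
  have hsT : Real.sqrt T ≤ 125 / 864 * h := by
    refine Real.sqrt_le_iff.2 ⟨by positivity, ?_⟩
    rw [hT, mul_pow]
    have : 0 < h ^ 2 := by positivity
    nlinarith
  have h2 : ∑' n, ENNReal.ofReal (L ^ 3 * ((Real.sqrt T * waveLength L n) ^ (0 + 1) * ‖a n‖ ^ 2))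
      ≤ ENNReal.ofReal (Real.sqrt T * h ^ 2) := by
    rw [ENNReal.ofReal_mul (Real.sqrt_nonneg T)]
    refine le_trans (le_of_eq ?_) (mul_le_mul_right hsum _)
    rw [← ENNReal.tsum_mul_left]
    refine tsum_congr fun n => ?_
    rw [← ENNReal.ofReal_mul (Real.sqrt_nonneg T)]
    congr 1
    ring
  have h3 := key.trans (mul_le_mul_right h2 _)
  rw [← ENNReal.ofReal_mul (by norm_num)] at h3
  calc ∫⁻ x, ‖w x‖ₑ ^ 3 = ENNReal.ofReal 3 * (ENNReal.ofReal (1 / 3) * ∫⁻ x, ‖w x‖ₑ ^ 3) := by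
        rw [← mul_assoc, ← ENNReal.ofReal_mul (by norm_num)]
        norm_num
    _ ≤ ENNReal.ofReal 3 * ENNReal.ofReal (4 / 3 * (Real.sqrt T * h ^ 2)) := by
        gcongr
        norm_num at h3 ⊢
        exact h3
    _ ≤ _ := by
        rw [← ENNReal.ofReal_mul (by norm_num)]
        refine ENNReal.ofReal_le_ofReal ?_
        have : 0 < h ^ 2 := by positivity
        have := mul_le_mul_of_nonneg_right hsT this.le
        rw [mul_pow]
        nlinarith

lemma ofReal_hNorm_sq {s : ℝ} {w : L2Field L} (hw : w ∈ HSpace L s) :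
    ∑' n, ENNReal.ofReal (L ^ 3 * (waveLength L n ^ (2 * s) * ‖coeff L w n‖ ^ 2))
      = ENNReal.ofReal (hNorm L s w ^ 2) := by
  have hL : 0 < L := Fact.out
  have hk (n : Fin 3 → ℤ) := waveLength_nonneg (L := L) n
  have hnn (n : Fin 3 → ℤ) : 0 ≤ waveLength L n ^ (2 * s) * ‖coeff L w n‖ ^ 2 :=
    mul_nonneg (Real.rpow_nonneg (hk n) _) (sq_nonneg _)
  rw [hNorm, Real.sq_sqrt (mul_nonneg (by positivity) (tsum_nonneg hnn)), ← tsum_mul_left,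
    ENNReal.ofReal_tsum_of_nonneg (fun n => mul_nonneg (by positivity) (hnn n))
      (hw.2.2.mul_left _)]

lemma hNorm_nonneg (s : ℝ) (w : L2Field L) : 0 ≤ hNorm L s w := Real.sqrt_nonneg _

lemma isSobolevBound_one : IsSobolevBound 1 (3 / 5) := by
  refine ⟨by norm_num, fun L _ w hw => ?_⟩
  have h0 := hNorm_nonneg 1 w
  have h := HasSeries.lintegral_pow_six_le hw.1 hw.2.1 h0 (by
    refine le_of_eq (Eq.trans (tsum_congr fun n => ?_) (ofReal_hNorm_sq hw))
    rw [mul_one, Real.rpow_two])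
  have h1 : ENNReal.ofReal (6 / (3 - 2 * 1)) = ENNReal.ofReal ((6 : ℕ) : ℝ) := by norm_num
  rw [h1]
  exact eLpNorm_le_of_lintegral_pow_le (by norm_num) (by positivity) h

lemma isSobolevBound_half : IsSobolevBound (1 / 2) (5 / 6) := by
  refine ⟨by norm_num, fun L _ w hw => ?_⟩
  have h0 := hNorm_nonneg (1 / 2) w
  have h := HasSeries.lintegral_pow_three_le hw.1 hw.2.1 h0 (by
    refine le_of_eq (Eq.trans (tsum_congr fun n => ?_) (ofReal_hNorm_sq hw))
    rw [mul_one_div_cancel two_ne_zero, Real.rpow_one])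
  have h1 : ENNReal.ofReal (6 / (3 - 2 * (1 / 2))) = ENNReal.ofReal ((3 : ℕ) : ℝ) := by norm_num
  rw [h1]
  exact eLpNorm_le_of_lintegral_pow_le (by norm_num) (by positivity) h

/-- The Sobolev constant is attained as soon as some constant is admissible. -/
lemma IsSobolevBound.isLeast {s S : ℝ} (hS : IsSobolevBound s S) :
    IsLeast {S | IsSobolevBound s S} (sobolevConst s) := by
  have hbdd : BddBelow {S | IsSobolevBound s S} := ⟨0, fun _ h => h.1⟩
  have hne : {S | IsSobolevBound s S}.Nonempty := ⟨S, hS⟩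
  refine ⟨⟨le_csInf hne fun _ h => h.1, fun L _ w hw => ?_⟩, fun _ h => csInf_le hbdd h⟩
  obtain ⟨u, -, hu, hmem⟩ := exists_seq_tendsto_sInf hne hbdd
  exact ge_of_tendsto' (ENNReal.tendsto_ofReal (hu.mul_const (hNorm L s w)))
    fun k => (hmem k).2 L w hw

lemma IsSobolevBound.sobolevConst_le {s S : ℝ} (hS : IsSobolevBound s S) : sobolevConst s ≤ S :=
  hS.isLeast.2 hS

/-- The numerical fact that lets `4C²` be replaced by `2C`. -/
lemma sobolevConst_mul_le : sobolevConst 1 * sobolevConst (1 / 2) ≤ 1 / 2 := by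
  have h1 := isSobolevBound_one.sobolevConst_le
  have h2 := isSobolevBound_half.sobolevConst_le
  calc sobolevConst 1 * sobolevConst (1 / 2) ≤ 3 / 5 * (5 / 6) :=
        mul_le_mul h1 h2 isSobolevBound_half.isLeast.1.1 (by norm_num)
    _ = 1 / 2 := by norm_num

/-! ### The filter and the deconvolution operator on Fourier series -/

/-- The symbol of the filter `G`. -/
def filterSymbol (L α p : ℝ) (n : Fin 3 → ℤ) : ℝ :=
  1 / (1 + α ^ (2 * p) * waveLength L n ^ (2 * p))

/-- The symbol of the deconvolution error `I - D_N G`. -/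
def errorSymbol (L α p : ℝ) (N : ℕ) (n : Fin 3 → ℤ) : ℝ :=
  (1 - filterSymbol L α p n) ^ (N + 1)


lemma filterSymbol_pos {α : ℝ} (hα : 0 < α) (p : ℝ) (n : Fin 3 → ℤ) : 0 < filterSymbol L α p n := by
  have := waveLength_nonneg (L := L) n
  unfold filterSymbol
  positivity

lemma filterSymbol_le_one {α : ℝ} (hα : 0 < α) (p : ℝ) (n : Fin 3 → ℤ) : filterSymbol L α p n ≤ 1 := by
  have := waveLength_nonneg (L := L) n
  unfold filterSymbol
  rw [div_le_one (by positivity)]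
  have : 0 ≤ α ^ (2 * p) * waveLength L n ^ (2 * p) := by positivity
  linarith

lemma errorSymbol_nonneg {α : ℝ} (hα : 0 < α) (p : ℝ) (N : ℕ) (n : Fin 3 → ℤ) :
    0 ≤ errorSymbol L α p N n :=
  pow_nonneg (sub_nonneg.2 (filterSymbol_le_one hα p n)) _

lemma errorSymbol_le_one {α : ℝ} (hα : 0 < α) (p : ℝ) (N : ℕ) (n : Fin 3 → ℤ) :
    errorSymbol L α p N n ≤ 1 :=
  pow_le_one₀ (sub_nonneg.2 (filterSymbol_le_one hα p n))
    (by linarith [filterSymbol_pos (L := L) hα p n])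

/-- Bernoulli for `(1 + 1/x)^{2m/q}`, whose exponent is at least `1` because `q ≤ 2` and `m ≥ 1`,
then the power `q` and inversion. It serves with `x = (α|k|)^{2p}`, `q = 1/(2p)` and `m = N + 1`,
where `x^q = α|k|`. -/
lemma pow_div_one_add_le {x q : ℝ} (hx : 0 < x) (hq : 0 < q) (hq2 : q ≤ 2) {m : ℕ} (hm : 1 ≤ m) :
    ((x / (1 + x)) ^ m) ^ 2 ≤ (q * x / m) ^ q := by
  have hm' : (1 : ℝ) ≤ m := by exact_mod_cast hm
  have hr : 1 ≤ 2 * (m : ℝ) / q := by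
    rw [le_div_iff₀ hq]
    linarith
  have h1 := one_add_mul_self_le_rpow_one_add (s := 1 / x) (by
    have : 0 < 1 / x := by positivity
    linarith) hr
  have h2 : m / (q * x) ≤ (1 + 1 / x) ^ (2 * (m : ℝ) / q) := by
    refine le_trans ?_ h1
    have : 2 * (m : ℝ) / q * (1 / x) = m / (q * x) + m / (q * x) := by
      field_simp
      ring
    have : 0 < m / (q * x) := by positivity
    linarith
  have h3 := Real.rpow_le_rpow (by positivity) h2 hq.le
  rw [← Real.rpow_mul (by positivity), div_mul_cancel₀ _ hq.ne'] at h3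
  have h4 : (x / (1 + x)) ^ m = ((1 + 1 / x) ^ m)⁻¹ := by
    rw [← inv_pow]
    congr 1
    field_simp
    ring
  have h5 : (1 + 1 / x) ^ (2 * (m : ℝ)) = ((1 + 1 / x) ^ m) ^ 2 := by
    rw [← pow_mul, ← Real.rpow_natCast]
    push_cast
    ring_nf
  have h6 : (q * x / m) ^ q = ((m / (q * x)) ^ q)⁻¹ := by
    rw [← Real.inv_rpow (by positivity), inv_div]
  rw [h4, h6, inv_pow, ← h5]
  gcongr

lemma errorSymbol_sq_le {α p : ℝ} (hα : 0 < α) (hp : 3 / 4 ≤ p) (N : ℕ) {n : Fin 3 → ℤ}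
    (hn : n ≠ 0) : errorSymbol L α p N n ^ 2
      ≤ α / (2 * p * (N + 1)) ^ (1 / (2 * p)) * waveLength L n := by
  have hk := waveLength_pos (L := L) hn
  have hp0 : 0 < p := by linarith
  set x := (α * waveLength L n) ^ (2 * p) with hx
  have hx0 : 0 < x := by positivity
  have h1 : 1 - filterSymbol L α p n = x / (1 + x) := by
    rw [filterSymbol, ← Real.mul_rpow hα.le hk.le, ← hx]
    field_simp
    ring
  have h2 := pow_div_one_add_le (x := x) (q := 1 / (2 * p)) hx0 (by positivity)
    (by rw [div_le_iff₀ (by positivity)]; linarith) (m := N + 1) (by omega)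
  have h3 : 1 / (2 * p) * x / ((N + 1 : ℕ) : ℝ) = x / (2 * p * (N + 1)) := by
    push_cast
    field_simp
  have h4 : x ^ (1 / (2 * p)) = α * waveLength L n := by
    rw [hx, ← Real.rpow_mul (by positivity), mul_one_div_cancel (by positivity), Real.rpow_one]
  rw [h3, Real.div_rpow hx0.le (by positivity), h4] at h2
  rw [errorSymbol, h1]
  refine h2.trans (le_of_eq ?_)
  ring



lemma HasSeries.filterG {α : ℝ} (hα : 0 < α) (p : ℝ) {w : L2Field L}
    {a : (Fin 3 → ℤ) → Vec} (hw : HasSeries w a) :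
    HasSeries (filterG L α p w) (fun n => filterSymbol L α p n • a n) := by
  -- The `tsum` defining the filter would be `0` by default if it diverged; a symbol in `(0, 1]`
  -- preserves square summability.
  have h := summable_norm_sq_smul hw.summable_norm_sq (c := filterSymbol L α p) fun n => by
    rw [abs_of_pos (filterSymbol_pos hα p n)]
    exact filterSymbol_le_one hα p n
  unfold DeconvResidual.filterG
  simp_rw [hw.coeff_eq]
  exact (summable_mode h).hasSum

lemma HasSeries.iterate {α : ℝ} (hα : 0 < α) (p : ℝ) {w : L2Field L}
    {a : (Fin 3 → ℤ) → Vec} (hw : HasSeries w a) (j : ℕ) :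
    HasSeries ((fun v => v - DeconvResidual.filterG L α p v)^[j] w)
      (fun n => (1 - filterSymbol L α p n) ^ j • a n) := by
  induction j with
  | zero => simpa using hw
  | succ j ih =>
    rw [Function.iterate_succ_apply']
    have h := ih.sub (ih.filterG hα p)
    have h2 (n : Fin 3 → ℤ) : (1 - filterSymbol L α p n) ^ j • a n
        - filterSymbol L α p n • (1 - filterSymbol L α p n) ^ j • a n
        = (1 - filterSymbol L α p n) ^ (j + 1) • a n := by
      rw [smul_smul, ← sub_smul]
      congr 1
      ring
    simp_rw [h2] at h
    exact h

lemma HasSeries.deconv_filterG {α : ℝ} (hα : 0 < α) (p : ℝ) {u : L2Field L}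
    {a : (Fin 3 → ℤ) → Vec} (hu : HasSeries u a) (N : ℕ) :
    HasSeries (deconv L α p N (DeconvResidual.filterG L α p u))
      (fun n => (1 - errorSymbol L α p N n) • a n) := by
  have h := HasSeries.sum (s := Finset.range (N + 1))
    fun j _ => (hu.filterG hα p).iterate hα p j
  have h2 (n : Fin 3 → ℤ) : ∑ j ∈ Finset.range (N + 1),
      (1 - filterSymbol L α p n) ^ j • filterSymbol L α p n • a n
      = (1 - errorSymbol L α p N n) • a n := by
    simp_rw [smul_smul]
    rw [← Finset.sum_smul, ← Finset.sum_mul]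
    congr 1
    -- Geometric sum of ratio `1 - g`, multiplied by `g = 1 - (1 - g)`.
    have := geom_sum_mul_neg (1 - filterSymbol L α p n) (N + 1)
    rwa [sub_sub_cancel] at this
  simp_rw [h2] at h
  exact h

lemma HasSeries.sub_deconv_filterG {α : ℝ} (hα : 0 < α) (p : ℝ) {u : L2Field L}
    {a : (Fin 3 → ℤ) → Vec} (hu : HasSeries u a) (N : ℕ) :
    HasSeries (u - deconv L α p N (DeconvResidual.filterG L α p u))
      (fun n => errorSymbol L α p N n • a n) := by
  have h := hu.sub (hu.deconv_filterG hα p N)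
  have h2 (n : Fin 3 → ℤ) : a n - (1 - errorSymbol L α p N n) • a n
      = errorSymbol L α p N n • a n := by
    rw [sub_smul, one_smul, sub_sub_cancel]
  simp_rw [h2] at h
  exact h

/-- A series whose coefficients satisfy `|k|^{2s} |b_n|² ≤ c |k|^{2r} |û_n|²` with `u ∈ ℍ_r` is in
`ℍ_s`, with the corresponding bound of norms. -/
lemma HasSeries.mem_HSpace_of_le {u w : L2Field L} {b : (Fin 3 → ℤ) → Vec} {r s c : ℝ}
    (hw : HasSeries w b) (hb : b 0 = 0) (hu : u ∈ HSpace L r)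
    (h : ∀ n, waveLength L n ^ (2 * s) * ‖b n‖ ^ 2
      ≤ c * (waveLength L n ^ (2 * r) * ‖coeff L u n‖ ^ 2)) :
    w ∈ HSpace L s ∧ hNorm L s w ^ 2 ≤ c * hNorm L r u ^ 2 := by
  have hL : 0 < L := Fact.out
  have hnn (s : ℝ) (v : Vec) (n : Fin 3 → ℤ) : 0 ≤ waveLength L n ^ (2 * s) * ‖v‖ ^ 2 :=
    mul_nonneg (Real.rpow_nonneg (waveLength_nonneg n) _) (sq_nonneg _)
  have hs : Summable fun n => waveLength L n ^ (2 * s) * ‖b n‖ ^ 2 :=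
    (hu.2.2.mul_left c).of_nonneg_of_le (fun n => hnn s _ n) h
  refine ⟨⟨?_, ?_, ?_⟩, ?_⟩
  · simp_rw [hw.coeff_eq]
    exact hw
  · rw [hw.coeff_eq, hb]
  · simp_rw [hw.coeff_eq]
    exact hs
  · rw [hNorm, hNorm, Real.sq_sqrt (mul_nonneg (by positivity) (tsum_nonneg fun n => hnn _ _ n)),
      Real.sq_sqrt (mul_nonneg (by positivity) (tsum_nonneg fun n => hnn _ _ n)), mul_left_comm,
      ← tsum_mul_left (a := c)]
    simp_rw [hw.coeff_eq]
    exact mul_le_mul_of_nonneg_left (hs.tsum_le_tsum h (hu.2.2.mul_left c)) (by positivity)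

/-! ### The residual stress -/

/-- With `w = u - v`, the difference is `u ⊗ w + w ⊗ v`; then `(s + t)² ≤ 2s² + 2t²` entrywise. -/
lemma enorm_sub_mul_sq_le (u v : Vec) :
    ∑ i, ∑ j, ‖u i * u j - v i * v j‖ₑ ^ 2
      ≤ 2 * (‖u - v‖ₑ ^ 2 * ‖u‖ₑ ^ 2) + 2 * (‖u - v‖ₑ ^ 2 * ‖v‖ₑ ^ 2) := by
  have hsq (z : Vec) : ‖z‖ ^ 2 = ∑ i, ‖z i‖ ^ 2 := EuclideanSpace.norm_sq_eq z
  have hreal : ∑ i, ∑ j, ‖u i * u j - v i * v j‖ ^ 2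
      ≤ 2 * (‖u - v‖ ^ 2 * ‖u‖ ^ 2) + 2 * (‖u - v‖ ^ 2 * ‖v‖ ^ 2) := by
    have hterm (i j : Fin 3) : ‖u i * u j - v i * v j‖ ^ 2
        ≤ 2 * (‖u i‖ ^ 2 * ‖(u - v) j‖ ^ 2) + 2 * (‖(u - v) i‖ ^ 2 * ‖v j‖ ^ 2) := by
      have h1 : u i * u j - v i * v j = u i * (u - v) j + (u - v) i * v j := by
        simp only [PiLp.sub_apply]
        ring
      have h2 : ‖u i * u j - v i * v j‖ ≤ ‖u i‖ * ‖(u - v) j‖ + ‖(u - v) i‖ * ‖v j‖ := by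
        rw [h1, ← norm_mul, ← norm_mul]
        exact norm_add_le _ _
      calc _ ≤ (‖u i‖ * ‖(u - v) j‖ + ‖(u - v) i‖ * ‖v j‖) ^ 2 := by gcongr
        _ ≤ 2 * ((‖u i‖ * ‖(u - v) j‖) ^ 2 + (‖(u - v) i‖ * ‖v j‖) ^ 2) := add_sq_le
        _ = _ := by ring
    refine (Finset.sum_le_sum fun i _ => Finset.sum_le_sum fun j _ => hterm i j).trans
      (le_of_eq ?_)
    rw [hsq u, hsq v, hsq (u - v)]
    simp only [Finset.sum_add_distrib, ← Finset.mul_sum, ← Finset.sum_mul]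
    ring
  have h := ENNReal.ofReal_le_ofReal hreal
  rw [ENNReal.ofReal_sum_of_nonneg fun i _ => by positivity,
    ENNReal.ofReal_add (by positivity) (by positivity)] at h
  simp_rw [ENNReal.ofReal_sum_of_nonneg (fun (j : Fin 3) (_ : j ∈ Finset.univ) => sq_nonneg
    (‖u _ * u j - v _ * v j‖))] at h
  simpa [ENNReal.ofReal_mul, ENNReal.ofReal_pow] using h

lemma lintegral_sq_mul_sq_le {w v : L2Field L} {A B : ℝ} (hA : 0 ≤ A) (hB : 0 ≤ B)
    (hw : eLpNorm w (ENNReal.ofReal 3) volume ≤ ENNReal.ofReal A)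
    (hv : eLpNorm v (ENNReal.ofReal 6) volume ≤ ENNReal.ofReal B) :
    ∫⁻ x, ‖w x‖ₑ ^ 2 * ‖v x‖ₑ ^ 2 ≤ ENNReal.ofReal (A ^ 2 * B ^ 2) := by
  have hmw : AEMeasurable (fun x => ‖w x‖ₑ ^ 2) :=
    ((Lp.stronglyMeasurable w).measurable.enorm.pow_const 2).aemeasurable
  have hmv : AEMeasurable (fun x => ‖v x‖ₑ ^ 2) :=
    ((Lp.stronglyMeasurable v).measurable.enorm.pow_const 2).aemeasurable
  -- Applied to the squares, these exponents pair `L³` of `w` with `L⁶` of `v`.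
  have hpq : (3 / 2 : ℝ).HolderConjugate 3 := by
    rw [Real.holderConjugate_iff]
    norm_num
  have h := ENNReal.lintegral_mul_le_Lp_mul_Lq volume hpq hmw hmv
  rw [eLpNorm_eq_lintegral_rpow_enorm_toReal (by norm_num) ENNReal.ofReal_ne_top,
    ENNReal.toReal_ofReal (by norm_num)] at hw hv
  have h1 : (∫⁻ x, (‖w x‖ₑ ^ 2) ^ (3 / 2 : ℝ)) ^ (1 / (3 / 2) : ℝ)
      = ((∫⁻ x, ‖w x‖ₑ ^ (3 : ℝ)) ^ (1 / 3 : ℝ)) ^ 2 := by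
    simp_rw [← ENNReal.rpow_natCast, ← ENNReal.rpow_mul]
    norm_num
  have h2 : (∫⁻ x, (‖v x‖ₑ ^ 2) ^ (3 : ℝ)) ^ (1 / 3 : ℝ)
      = ((∫⁻ x, ‖v x‖ₑ ^ (6 : ℝ)) ^ (1 / 6 : ℝ)) ^ 2 := by
    simp_rw [← ENNReal.rpow_natCast, ← ENNReal.rpow_mul]
    norm_num
  rw [h1, h2] at h
  refine h.trans ?_
  rw [ENNReal.ofReal_mul (by positivity), ENNReal.ofReal_pow hA, ENNReal.ofReal_pow hB]
  gcongr

lemma l2NormSq_residualStress_le {α p : ℝ} {N : ℕ} {u : L2Field L} {A B : ℝ} (hA : 0 ≤ A)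
    (hB : 0 ≤ B)
    (hw : eLpNorm (u - deconv L α p N (filterG L α p u) : L2Field L) (ENNReal.ofReal 3) volume
      ≤ ENNReal.ofReal A)
    (hu : eLpNorm u (ENNReal.ofReal 6) volume ≤ ENNReal.ofReal B)
    (hv : eLpNorm (deconv L α p N (filterG L α p u)) (ENNReal.ofReal 6) volume
      ≤ ENNReal.ofReal B) :
    l2NormSq L (residualStress L α p N u) ≤ ENNReal.ofReal (4 * (A ^ 2 * B ^ 2)) := by
  set v := deconv L α p N (filterG L α p u) with hvdef
  have hm (z : L2Field L) : Measurable fun x => ‖z x‖ₑ ^ 2 :=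
    (Lp.stronglyMeasurable z).measurable.enorm.pow_const 2
  have hmwu : Measurable fun x => ‖(u - v) x‖ₑ ^ 2 * ‖u x‖ₑ ^ 2 := (hm (u - v)).mul (hm u)
  have hmwv : Measurable fun x => ‖(u - v) x‖ₑ ^ 2 * ‖v x‖ₑ ^ 2 := (hm (u - v)).mul (hm v)
  calc l2NormSq L (residualStress L α p N u)
      ≤ ∫⁻ x, (2 * (‖(u - v) x‖ₑ ^ 2 * ‖u x‖ₑ ^ 2) + 2 * (‖(u - v) x‖ₑ ^ 2 * ‖v x‖ₑ ^ 2)) := by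
        refine lintegral_mono_ae ?_
        filter_upwards [Lp.coeFn_sub u v] with x hx
        rw [hx, Pi.sub_apply]
        exact enorm_sub_mul_sq_le (u x) (v x)
    _ = 2 * (∫⁻ x, ‖(u - v) x‖ₑ ^ 2 * ‖u x‖ₑ ^ 2) + 2 * ∫⁻ x, ‖(u - v) x‖ₑ ^ 2 * ‖v x‖ₑ ^ 2 := by
        rw [lintegral_add_left (hmwu.const_mul 2), lintegral_const_mul _ hmwu,
          lintegral_const_mul _ hmwv]
    _ ≤ 2 * ENNReal.ofReal (A ^ 2 * B ^ 2) + 2 * ENNReal.ofReal (A ^ 2 * B ^ 2) := by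
        gcongr
        · exact lintegral_sq_mul_sq_le hA hB hw hu
        · exact lintegral_sq_mul_sq_le hA hB hw hv
    _ = _ := by
        rw [← add_mul, ENNReal.ofReal_mul (by norm_num : (0 : ℝ) ≤ 4), ENNReal.ofReal_ofNat]
        norm_num

end DeconvResidual

end

/-! ### The lemma on the residual stress -/

open DeconvResidual in
theorem lemma4p1 :
    IsLeast {S | IsSobolevBound 1 S} (sobolevConst 1) ∧
    IsLeast {S | IsSobolevBound (1 / 2) S} (sobolevConst (1 / 2)) ∧
    ∀ (L : ℝ) [Fact (0 < L)] (α p : ℝ) (N : ℕ), 0 < α → 3 / 4 ≤ p →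
      ∀ u ∈ HSpace L 1,
        u - deconv L α p N (filterG L α p u) ∈ HSpace L (1 / 2) ∧
        l2NormSq L (residualStress L α p N u) ≤
          ENNReal.ofReal (2 * (sobolevConst 1 * sobolevConst (1 / 2)) * hNorm L 1 u ^ 2 *
            hNorm L (1 / 2) (u - deconv L α p N (filterG L α p u)) ^ 2) ∧
        hNorm L (1 / 2) (u - deconv L α p N (filterG L α p u)) ^ 2 ≤
          α / (2 * p * (N + 1)) ^ (1 / (2 * p)) * hNorm L 1 u ^ 2 := by
  have hS1 := isSobolevBound_one.isLeast
  have hS2 := isSobolevBound_half.isLeast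
  refine ⟨hS1, hS2, fun L _ α p N hα hp u hu => ?_⟩
  have hL : 0 < L := Fact.out
  have hcoeff : HasSeries u (coeff L u) := hu.1
  obtain ⟨hw, hwle⟩ := (HasSeries.sub_deconv_filterG hα p hcoeff N).mem_HSpace_of_le (s := 1 / 2)
    (c := α / (2 * p * (N + 1)) ^ (1 / (2 * p))) (by simp [hu.2.1]) hu fun n => by
      rcases eq_or_ne n 0 with rfl | hn
      · simp [hu.2.1]
      have hk := waveLength_pos (L := L) hn
      have h := errorSymbol_sq_le (L := L) hα hp N hn
      rw [mul_one_div_cancel two_ne_zero, Real.rpow_one, mul_one, Real.rpow_two, norm_smul, mul_pow,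
        Real.norm_eq_abs, sq_abs]
      calc waveLength L n * (errorSymbol L α p N n ^ 2 * ‖coeff L u n‖ ^ 2)
          ≤ waveLength L n * (α / (2 * p * (N + 1)) ^ (1 / (2 * p)) * waveLength L n
              * ‖coeff L u n‖ ^ 2) := by gcongr
        _ = _ := by ring
  -- The symbol of `D_N G` lies in `[0, 1]`, so `D_N ū` obeys the same `L⁶` bound as `u`.
  obtain ⟨hv, hvle⟩ := (HasSeries.deconv_filterG hα p hcoeff N).mem_HSpace_of_le (s := 1) (c := 1)
    (by simp [hu.2.1]) hu fun n => by
      have h0 := errorSymbol_nonneg (L := L) hα p N n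
      have h1 := errorSymbol_le_one (L := L) hα p N n
      have hk := waveLength_nonneg (L := L) n
      rw [one_mul, norm_smul, Real.norm_of_nonneg (by linarith)]
      gcongr
      exact mul_le_of_le_one_left (norm_nonneg _) (by linarith)
  rw [one_mul, pow_le_pow_iff_left₀ (hNorm_nonneg _ _) (hNorm_nonneg _ _) two_ne_zero] at hvle
  refine ⟨hw, ?_, hwle⟩
  have hC := sobolevConst_mul_le
  have hC1 := hS1.1.1
  have hC2 := hS2.1.1
  have hn1 := hNorm_nonneg 1 u
  have hn2 := hNorm_nonneg (1 / 2) (u - deconv L α p N (filterG L α p u))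
  have e3 : (6 / (3 - 2 * (1 / 2)) : ℝ) = 3 := by norm_num
  have e6 : (6 / (3 - 2 * 1) : ℝ) = 6 := by norm_num
  have hwS := hS2.1.2 L _ hw
  have huS := hS1.1.2 L _ hu
  have hvS := hS1.1.2 L _ hv
  rw [e3] at hwS
  rw [e6] at huS hvS
  refine (l2NormSq_residualStress_le (mul_nonneg hC2 hn2) (mul_nonneg hC1 hn1) hwS huS
    (hvS.trans (ENNReal.ofReal_le_ofReal (by gcongr)))).trans (ENNReal.ofReal_le_ofReal ?_)
  set C := sobolevConst 1 * sobolevConst (1 / 2) with hCdef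
  have hC0 : 0 ≤ C := mul_nonneg hC1 hC2
  calc _ = 4 * C * C * (hNorm L 1 u ^ 2
          * hNorm L (1 / 2) (u - deconv L α p N (filterG L α p u)) ^ 2) := by
        rw [hCdef]
        ring
    -- Here `C ≤ 1/2` enters, as `4C² ≤ 2C`.
    _ ≤ 2 * C * (hNorm L 1 u ^ 2
          * hNorm L (1 / 2) (u - deconv L α p N (filterG L α p u)) ^ 2) := by
        gcongr
        nlinarith
    _ = _ := by ring
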